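/- **Theorem 1 (Exact recovery).** For $x,z\in\mathbb C^n$ let $\operatorname{dist}(x,z)=\min_{\phi\in[0,2\pi)}\|xe^{i\phi}-z\|$ and $\mathcal S_x(\rho)=\{z\in\mathbb C^n:\operatorname{dist}(x,z)\le\rho\|x\|\}$. *Parameters.* Put $\rho_1=\frac{2\sqrt{76015}-276}{2477}$, $\rho_2=\frac{2\sqrt{39}-12}{3}$, $t_2=\frac{8075-\sqrt{45678865}}{990}$. Let $0<\alpha_1\le\alpha_2$ and $0<\rho\le\rho_2$ satisfy $$\alpha_2<3\alpha_1-(\rho+1)^2\ \text{ if }\rho\le\rho_1,\qquad \alpha_2<\Big(3-\tfrac{(3-t_2)(\rho-\rho_1)}{1/6-\rho_1}\Big)\alpha_1-(\rho+1)^2\ \text{ if }\rho_1<\rho\le\rho_2 .$$ Let $U=(1+\rho)^2+\alpha_2$, $L_1=(1-\rho)^2+\alpha_1$ and, for $\delta,\delta'>0$, $$\phi_1=\tfrac{1-6\rho}{4U}-\tfrac{\rho^2}{16L_1}-\tfrac{\delta}{4},\quad \phi_2=\tfrac{9+16\rho^2}{32U}-\tfrac{3}{32\alpha_1}-\tfrac{\delta}{4},\quad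 \psi=\tfrac{63}{128U}-\tfrac{9}{128\alpha_1},\quad \varphi=\tfrac{81U\rho^2}{U^2(7+16U\psi)},$$ $$l_{cur}=\min\Big\{\tfrac{\phi_1+\phi_2-\varphi}{4},\ \tfrac{2-3\rho+\rho^2}{(1+\rho)^2+\alpha_2}(1-\delta)\Big\}-\delta,\qquad u_{smo}=\Big(1+\tfrac1{2\sqrt{\alpha_1}}\Big)(1+\delta').$$ *Claim.* First, $l_{cur}>0$ for all sufficiently small $\delta>0$. Second, for all $\delta,\delta'>0$ with $l_{cur}>0$ there are constants $C,c>0$, depending only on $\alpha_1,\alpha_2,\rho,\delta,\delta'$, such that the following holds for all $n$, all $m\ge Cn$ and all $x\in\mathbb C^n$. Let $a_1,\dots,a_m\in\mathbb C^n$ be independent random vectors with law $\mathcal N(0,I_n/2)+i\,\mathcal N(0,I_n/2)$ (independent real and imaginary parts), and let $0<\mu<2l_{cur}/u_{smo}^2$. Then $t:=\mu(2l_{cur}-\mu u_{smo}^2)>0$, and for every $k\ge0$, with probability at least $1-(k+1)\exp(-cn)$ over $a_1,\dots,a_m$, we have $$\operatorname{dist}^2(z_{k+1},x)\le(1-t)^{k+1}\operatorname{dist}^2(z_0,x)$$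 simultaneously for all $b\in\mathbb R^m$ with $\alpha_1|a_j^*x|^2\le b_j\le\alpha_2|a_j^*x|^2$ ($j=1,\dots,m$) and all $z_0\in\mathcal S_x(\rho)$ (so $b$ and $z_0$ may depend on the $a_j$). Here $y_j=|a_j^*x|^2+b_j$ are the noiseless data, and $z_{k+1}=z_k-\mu\nabla f(z_k)$ is Wirtinger Flow for $$f(z)=\frac1m\sum_{j=1}^m\big(|a_j^*z|^2+b_j-y_j\log(|a_j^*z|^2+b_j)\big),\qquad \nabla f(z)=\frac1m\sum_{j=1}^m\Big(1-\frac{y_j}{|a_j^*z|^2+b_j}\Big)a_ja_j^*z,$$ where a term with $a_j^*z=0$ counts as $0$ in $\nabla f(z)$. Thus Wirtinger Flow converges linearly to $x$ up to a global phase. -/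

import Mathlib

open MeasureTheory ProbabilityTheory
open scoped NNReal ENNReal

noncomputable section

namespace PoissonWF

/-- The distance up to a global phase, `dist(x, z) = min_{φ ∈ [0, 2π)} ‖x e^{iφ} - z‖`. -/
def phaseDist {n : ℕ} (x z : EuclideanSpace ℂ (Fin n)) : ℝ :=
  ⨅ φ : Set.Ico (0 : ℝ) (2 * Real.pi), ‖Complex.exp (Complex.I * (φ : ℝ)) • x - z‖

/-- The infimum in `phaseDist` is a minimum. -/
theorem exists_phaseDist_eq {n : ℕ} (x z : EuclideanSpace ℂ (Fin n)) :
    ∃ φ ∈ Set.Ico (0 : ℝ) (2 * Real.pi),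
      phaseDist x z = ‖Complex.exp (Complex.I * (φ : ℝ)) • x - z‖ := by
  have hpi : (0 : ℝ) < 2 * Real.pi := by positivity
  obtain ⟨φ, hφ, hmin⟩ := (isCompact_Icc (a := (0 : ℝ)) (b := 2 * Real.pi)).exists_isMinOn
    (Set.nonempty_Icc.2 hpi.le)
    (f := fun φ : ℝ => ‖Complex.exp (Complex.I * (φ : ℝ)) • x - z‖)
    (by fun_prop)
  have key : ∃ ψ ∈ Set.Ico (0 : ℝ) (2 * Real.pi), ∀ θ ∈ Set.Icc (0 : ℝ) (2 * Real.pi),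
      ‖Complex.exp (Complex.I * (ψ : ℝ)) • x - z‖
        ≤ ‖Complex.exp (Complex.I * (θ : ℝ)) • x - z‖ := by
    rcases eq_or_lt_of_le hφ.2 with h | h
    · refine ⟨0, ⟨le_rfl, hpi⟩, fun θ hθ => ?_⟩
      have h1 := hmin hθ
      rw [h] at h1
      have h2 : Complex.exp (Complex.I * ((2 * Real.pi : ℝ) : ℂ)) = 1 := by
        rw [mul_comm]; push_cast; exact Complex.exp_two_pi_mul_I
      have h3 : ‖Complex.exp (Complex.I * ((2 * Real.pi : ℝ) : ℂ)) • x - z‖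
          ≤ ‖Complex.exp (Complex.I * (θ : ℝ)) • x - z‖ := h1
      rw [h2] at h3
      simpa using h3
    · exact ⟨φ, ⟨hφ.1, h⟩, fun θ hθ => hmin hθ⟩
  obtain ⟨ψ, hψ, hle⟩ := key
  have : Nonempty (Set.Ico (0 : ℝ) (2 * Real.pi)) := ⟨⟨ψ, hψ⟩⟩
  refine ⟨ψ, hψ, le_antisymm ?_ ?_⟩
  · exact ciInf_le ⟨0, by rintro _ ⟨θ, rfl⟩; exact norm_nonneg _⟩
      (⟨ψ, hψ⟩ : Set.Ico (0 : ℝ) (2 * Real.pi))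
  · exact le_ciInf fun θ => hle θ ⟨θ.2.1, θ.2.2.le⟩

/-- The `ρ`-neighbourhood of `x`: all `z` with `dist(x, z) ≤ ρ ‖x‖`. -/
def nbhd {n : ℕ} (x : EuclideanSpace ℂ (Fin n)) (ρ : ℝ) : Set (EuclideanSpace ℂ (Fin n)) :=
  {z | phaseDist x z ≤ ρ * ‖x‖}

/-- The vector `u + i v` of `ℂⁿ` built from the `n` pairs `(u i, v i)`. -/
def toComplexVec {n : ℕ} (p : Fin n → ℝ × ℝ) : EuclideanSpace ℂ (Fin n) :=
  WithLp.toLp 2 fun i => ((p i).1 : ℂ) + ((p i).2 : ℂ) * Complex.I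

theorem measurable_toComplexVec {n : ℕ} : Measurable (toComplexVec (n := n)) := by
  unfold toComplexVec
  exact (WithLp.measurable_toLp 2 _).comp (by fun_prop)

/-- The law of a standard complex Gaussian vector, `N(0, Iₙ/2) + i N(0, Iₙ/2)`. -/
def complexGaussian (n : ℕ) : Measure (EuclideanSpace ℂ (Fin n)) :=
  (Measure.pi fun _ : Fin n =>
    (gaussianReal 0 (1 / 2 : ℝ≥0)).prod (gaussianReal 0 (1 / 2 : ℝ≥0))).map toComplexVec

instance (n : ℕ) : IsProbabilityMeasure (complexGaussian n) :=
  Measure.isProbabilityMeasure_map measurable_toComplexVec.aemeasurable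

/-- The Poisson negative log-likelihood
`f(z) = (1/m) ∑ⱼ (|aⱼ* z|² + bⱼ - yⱼ log(|aⱼ* z|² + bⱼ))`.
The inner product `inner ℂ a z = a* z` is conjugate-linear in its first argument. -/
def loss {n m : ℕ} (a : Fin m → EuclideanSpace ℂ (Fin n)) (b y : Fin m → ℝ)
    (z : EuclideanSpace ℂ (Fin n)) : ℝ :=
  (1 / (m : ℝ)) * ∑ j, (‖inner ℂ (a j) z‖ ^ 2 + b j
    - y j * Real.log (‖inner ℂ (a j) z‖ ^ 2 + b j))

/-- The Wirtinger gradient of `loss`,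
`∇f(z) = (1/m) ∑ⱼ (1 - yⱼ / (|aⱼ* z|² + bⱼ)) aⱼ aⱼ* z`. -/
def grad {n m : ℕ} (a : Fin m → EuclideanSpace ℂ (Fin n)) (b y : Fin m → ℝ)
    (z : EuclideanSpace ℂ (Fin n)) : EuclideanSpace ℂ (Fin n) :=
  (1 / (m : ℂ)) • ∑ j,
    (((1 - y j / (‖inner ℂ (a j) z‖ ^ 2 + b j) : ℝ) : ℂ) * inner ℂ (a j) z) • a j

/-- `grad` is the Wirtinger gradient of `loss`: where `loss` is differentiable term by term, its
real differential at `z` is `h ↦ 2 Re (∇f(z)* h)`. -/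
theorem hasFDerivAt_loss {n m : ℕ} (a : Fin m → EuclideanSpace ℂ (Fin n)) (b y : Fin m → ℝ)
    (z : EuclideanSpace ℂ (Fin n)) (hz : ∀ j, y j = 0 ∨ ‖inner ℂ (a j) z‖ ^ 2 + b j ≠ 0) :
    HasFDerivAt (loss a b y)
      ((2 : ℝ) • Complex.reCLM.comp ((innerSL ℂ (grad a b y z)).restrictScalars ℝ)) z := by
  have hterm : ∀ j, HasFDerivAt
      (fun w : EuclideanSpace ℂ (Fin n) => ‖inner ℂ (a j) w‖ ^ 2 + b j
        - y j * Real.log (‖inner ℂ (a j) w‖ ^ 2 + b j))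
      ((1 - y j / (‖inner ℂ (a j) z‖ ^ 2 + b j)) •
        ((2 : ℝ) • (innerSL ℝ (inner ℂ (a j) z : ℂ)).comp
          ((innerSL ℂ (a j)).restrictScalars ℝ))) z := by
    intro j
    have h1 : HasFDerivAt (fun w : EuclideanSpace ℂ (Fin n) => (inner ℂ (a j) w : ℂ))
        ((innerSL ℂ (a j)).restrictScalars ℝ) z :=
      ((innerSL ℂ (a j)).restrictScalars ℝ).hasFDerivAt
    have h2 := (h1.norm_sq).add_const (b j)
    rcases hz j with h | h
    · simpa [h, two_smul] using h2
    · have h3 := h2.sub ((h2.log h).const_mul (y j))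
      refine h3.congr_fderiv ?_
      ext w
      simp
      ring_nf
  have hsum := (HasFDerivAt.fun_sum (u := Finset.univ) fun j _ => hterm j).const_mul (1 / (m : ℝ))
  refine hsum.congr_fderiv ?_
  ext w
  simp only [grad, one_div, smul_apply, sum_apply,
    ContinuousLinearMap.comp_apply, ContinuousLinearMap.coe_restrictScalars', innerSL_apply_apply,
    smul_eq_mul, Complex.reCLM_apply, inner_smul_left, sum_inner]
  have hm : (starRingEnd ℂ) ((m : ℂ)⁻¹) = (((m : ℝ)⁻¹ : ℝ) : ℂ) := by simp
  rw [hm, Complex.re_ofReal_mul, Complex.re_sum, mul_left_comm (2 : ℝ) ((m : ℝ)⁻¹),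
    Finset.mul_sum (a := (2 : ℝ))]
  refine congrArg (((m : ℝ)⁻¹) * ·) ?_
  refine Finset.sum_congr rfl fun j _ => ?_
  rw [map_mul, Complex.conj_ofReal, mul_assoc, Complex.re_ofReal_mul, Complex.inner]
  ring_nf

/-- Wirtinger Flow: `z_{k+1} = z_k - μ ∇f(z_k)`, started at `z₀`. -/
def wf {n m : ℕ} (a : Fin m → EuclideanSpace ℂ (Fin n)) (b y : Fin m → ℝ) (μ : ℝ)
    (z₀ : EuclideanSpace ℂ (Fin n)) : ℕ → EuclideanSpace ℂ (Fin n)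
  | 0 => z₀
  | k + 1 => wf a b y μ z₀ k - (μ : ℂ) • grad a b y (wf a b y μ z₀ k)

/-- The noiseless data `yⱼ = |aⱼ* x|² + bⱼ`. -/
def data {n m : ℕ} (a : Fin m → EuclideanSpace ℂ (Fin n)) (b : Fin m → ℝ)
    (x : EuclideanSpace ℂ (Fin n)) : Fin m → ℝ :=
  fun j => ‖inner ℂ (a j) x‖ ^ 2 + b j

/-- The smoothness constant, with slack `δ`. -/
def uSmo (α₁ δ : ℝ) : ℝ := (1 + 1 / (2 * Real.sqrt α₁)) * (1 + δ)

/-- `U = (1 + ρ)² + α₂`. -/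
def bigU (α₂ ρ : ℝ) : ℝ := (1 + ρ) ^ 2 + α₂

/-- `L₁ = (1 - ρ)² + α₁`. -/
def bigL (α₁ ρ : ℝ) : ℝ := (1 - ρ) ^ 2 + α₁

/-- `φ₁`, including its slack `δ / 4`. -/
def phiOne (α₁ α₂ ρ δ : ℝ) : ℝ :=
  (1 - 6 * ρ) / (4 * bigU α₂ ρ) - ρ ^ 2 / (16 * bigL α₁ ρ) - δ / 4

/-- `φ₂`, including its slack `δ / 4`; here `L₂ = α₁`. -/
def phiTwo (α₁ α₂ ρ δ : ℝ) : ℝ :=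
  (9 + 16 * ρ ^ 2) / (32 * bigU α₂ ρ) - 3 / (32 * α₁) - δ / 4

/-- `ψ`, with `L₂ = α₁`. -/
def psi (α₁ α₂ ρ : ℝ) : ℝ := 63 / (128 * bigU α₂ ρ) - 9 / (128 * α₁)

/-- `φ = 81 U ρ² / (U² (7 + 16 U ψ))`, with `U₁ = U₂ = U`. -/
def varphi (α₁ α₂ ρ : ℝ) : ℝ :=
  81 * bigU α₂ ρ * ρ ^ 2 / (bigU α₂ ρ ^ 2 * (7 + 16 * bigU α₂ ρ * psi α₁ α₂ ρ))

/-- The curvature constant, at the largest relative distance `ρ` (the expression decreases in the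
relative distance), with slack `δ`. -/
def lCur (α₁ α₂ ρ δ : ℝ) : ℝ :=
  min ((phiOne α₁ α₂ ρ δ + phiTwo α₁ α₂ ρ δ - varphi α₁ α₂ ρ) / 4)
    ((2 - 3 * ρ + ρ ^ 2) / ((1 + ρ) ^ 2 + α₂) * (1 - δ)) - δ

/-- `ρ₁ ≈ 0.11119`. -/
def rhoOne : ℝ := (2 * Real.sqrt 76015 - 276) / 2477

/-- `ρ₂ ≈ 0.16333`. -/
def rhoTwo : ℝ := (2 * Real.sqrt 39 - 12) / 3

/-- `t₂ ≈ 1.32968`. -/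
def tTwo : ℝ := (8075 - Real.sqrt 45678865) / 990

/-- The admissible parameters: `0 < α₁ ≤ α₂`, `0 < ρ ≤ ρ₂`, and the upper bound on `α₂`. -/
def Admissible (α₁ α₂ ρ : ℝ) : Prop :=
  0 < α₁ ∧ α₁ ≤ α₂ ∧
    ((0 < ρ ∧ ρ ≤ rhoOne ∧ α₂ < 3 * α₁ - (ρ + 1) ^ 2) ∨
      (rhoOne < ρ ∧ ρ ≤ rhoTwo ∧
        α₂ < (3 - (3 - tTwo) * (ρ - rhoOne) / (1 / 6 - rhoOne)) * α₁ - (ρ + 1) ^ 2))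

/-- The contraction rate `t = μ (2 l - μ u²)`. -/
def rate (l u μ : ℝ) : ℝ := μ * (2 * l - μ * u ^ 2)

end PoissonWF

end

noncomputable section

namespace PoissonWF

/-! Rotate `z` by the phase that realizes its distance to `x`. The flow commutes with this rotation,
and `h = z - x` then satisfies `Im ⟨x, h⟩ = 0`. If `Re ⟨h, ∇f(x + h)⟩ ≥ l ‖h‖²` and `‖∇f(x + h)‖ ≤ u
‖h‖`, expanding `‖h - μ ∇f‖²` gives the factor `1 - t`. Distances never grow, so the iterates stay
in the neighbourhood and one event serves every `k`; the factor `k + 1` in the probability is slack.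

Since `b` and `z₀` may depend on the sample, `b` is removed by pointwise inequalities. Put `u = a*
x`, `v = a* h`. The gradient coefficient is at most `(1 + 1 / (2 √α₁)) |v|` (`norm_grad_coeff_le`),
so smoothness only needs an upper bound on the mean of `|a* h|²`. For the curvature, `le_curvTerm`
bounds `U` times each term below by `phaseRe² - |v|²/4 - 3 excess²`, where the excess of `|v|` over
`2|u|/5` pays for the rare measurements with small `|u|`.

For unit `x` and `h` the three Gaussian means are at least `1/2`, equal to `1`, and, with threshold
`2 / (5ρ)` for the excess, at most `2.35 ρ²`. Hence `U` times the mean curvature is at least `1/4 -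
7.05 ρ²`. The prescribed constant satisfies `U l_cur ≤ 0.109375 - 0.375 ρ - 1.34 ρ²`
(`bigU_mul_lCur_le`), which for `ρ < 0.16334` leaves a fixed gap. Accuracy `0.005` in the moments
therefore suffices whatever `δ` is; only the smoothness bound needs accuracy `δ'`.

The three functions are nonnegative, dominated by `|v|` and 1-Lipschitz in `v` (`IsGauge`). A
Chernoff bound at each point, a net of the sphere and a quadratic perturbation estimate give
concentration uniformly in `h` (`IsGauge.concentration`). Positivity of `l_cur` for small `δ` is
separate algebra (`phi_sum_pos`). -/

/-! ### Pointwise lower bound for the curvature. -/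

/-- Curvature minorant, normalized to `|u| = 1`, on the region `2p + s² ≥ 0`. -/
theorem curv_norm_pos {p s : ℝ} (hs : 0 ≤ s) (hp : |p| ≤ s) (h : 0 ≤ 2 * p + s ^ 2) {T : ℝ}
    (hT : s - 2 / 5 ≤ T) :
    (3 / 2 + (2 * p + s ^ 2)) * (p ^ 2 - s ^ 2 / 4 - 3 * T ^ 2)
      ≤ 3 / 2 * ((2 * p + s ^ 2) * (p + s ^ 2)) := by
  have hpq : p ^ 2 ≤ s ^ 2 := sq_le_sq' (abs_le.1 hp).1 (abs_le.1 hp).2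
  have hp0 : 0 ≤ p + s ^ 2 := by nlinarith [sq_nonneg s]
  rcases le_total s 1 with h1 | h1
  · have hq : s ^ 2 ≤ 1 := pow_le_one₀ hs h1
    have h2 : (3 / 2 + (2 * p + s ^ 2)) * (p ^ 2 - s ^ 2 / 4 - 3 * T ^ 2)
        ≤ (3 / 2 + (2 * p + s ^ 2)) * (p ^ 2 - s ^ 2 / 4) := by
      exact mul_le_mul_of_nonneg_left (by nlinarith [sq_nonneg T]) (by linarith)
    refine h2.trans ?_
    generalize s ^ 2 = q at *
    have hq0 : 0 ≤ q := by nlinarith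
    rcases le_total 0 p with h3 | h3
    · nlinarith [mul_nonneg h3 (sub_nonneg.2 hpq), mul_nonneg hq0 (sub_nonneg.2 hpq),
        mul_nonneg h3 hq0, sq_nonneg p]
    · have h4 : 0 ≤ (q + 2 * p) * (17 / 8 * q + 3 / 4 * p - p ^ 2) := by
        apply mul_nonneg (by linarith)
        nlinarith
      nlinarith [mul_nonneg hq0 (sub_nonneg.2 hq)]
  · have hT2 : (s - 2 / 5) ^ 2 ≤ T ^ 2 := pow_le_pow_left₀ (by linarith) hT 2
    -- For `s ≥ 1` one has `s - 2/5 ≥ 3s/5`, so `3 T² ≥ 27/25 s²` outweighs `p² - s²/4 ≤ 3/4 s²`.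
    have h2 : p ^ 2 - s ^ 2 / 4 - 3 * T ^ 2 ≤ 0 := by nlinarith
    exact (mul_nonpos_of_nonneg_of_nonpos (by linarith) h2).trans (by positivity)

/-- Curvature minorant, normalized to `|u| = 1`, on the region `p + s² ≤ 0`. -/
theorem curv_norm_mid {p s : ℝ} (hs : 0 ≤ s) (hp : |p| ≤ s) (h : p + s ^ 2 ≤ 0) {T : ℝ}
    (hT : s - 2 / 5 ≤ T) :
    p ^ 2 - s ^ 2 / 4 - 3 * T ^ 2 ≤ (2 * p + s ^ 2) * (p + s ^ 2) := by
  obtain ⟨h1, h2⟩ := abs_le.1 hp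
  rcases le_total s (2 / 5) with h3 | h3
  · nlinarith [sq_nonneg (p + 3 / 2 * s ^ 2), mul_nonneg (mul_nonneg hs hs) (sub_nonneg.2 h3),
      mul_nonneg (mul_nonneg (mul_nonneg hs hs) hs) (sub_nonneg.2 h3), sq_nonneg T]
  · have hT2 : (s - 2 / 5) ^ 2 ≤ T ^ 2 := pow_le_pow_left₀ (by linarith) hT 2
    -- As a quadratic in `p` the difference has its vertex at `p = -3/2 s²`, which obeys `p ≥ -s`
    -- only for `s ≤ 2/3`. Beyond that the minimum is at the endpoint `p = -s`.
    rcases le_total s (2 / 3) with h4 | h4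
    · have : 0 ≤ -5 / 4 * s ^ 4 + 13 / 4 * s ^ 2 - 12 / 5 * s + 12 / 25 := by
        nlinarith [sq_nonneg (s - 9 / 20), sq_nonneg (s * (s - 9 / 20)),
          mul_nonneg (sub_nonneg.2 h3) (sub_nonneg.2 h4),
          mul_nonneg (mul_nonneg (sub_nonneg.2 h3) (sub_nonneg.2 h4)) (sq_nonneg s),
          mul_nonneg (mul_nonneg (sub_nonneg.2 h3) (sub_nonneg.2 h4)) (sq_nonneg (s - 9 / 20)),
          mul_nonneg (mul_nonneg (sub_nonneg.2 h3) (sub_nonneg.2 h4)) hs]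
      nlinarith [sq_nonneg (p + 3 / 2 * s ^ 2)]
    · have h5 : s ≤ 1 := by nlinarith
      have h6 : 0 ≤ (p + s) * (p - s + 3 * s ^ 2) := mul_nonneg (by linarith) (by nlinarith)
      have : 0 ≤ s ^ 4 - 3 * s ^ 3 + 17 / 4 * s ^ 2 - 12 / 5 * s + 12 / 25 := by
        nlinarith [sq_nonneg (s ^ 2 - 3 / 2 * s + 1 / 2), sq_nonneg (s - 2 / 3)]
      nlinarith

/-- Curvature minorant, normalized to `|u| = 1`, on the region where the curvature is negative. -/
theorem curv_norm_neg {p s : ℝ} (hs : 0 ≤ s) (hp : |p| ≤ s) (h : 2 * p + s ^ 2 ≤ 0) {T : ℝ}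
    (hT : s - 2 / 5 ≤ T) :
    p ^ 2 - s ^ 2 / 4 - 3 * T ^ 2 ≤ 3 * ((2 * p + s ^ 2) * (p + s ^ 2)) := by
  obtain ⟨h1, h2⟩ := abs_le.1 hp
  rcases le_total s (2 / 5) with h3 | h3
  · nlinarith [sq_nonneg (p + 9 / 10 * s ^ 2), mul_nonneg (mul_nonneg hs hs) (sub_nonneg.2 h3),
      mul_nonneg (mul_nonneg (mul_nonneg hs hs) hs) (sub_nonneg.2 h3), sq_nonneg T]
  · have hT2 : (s - 2 / 5) ^ 2 ≤ T ^ 2 := pow_le_pow_left₀ (by linarith) hT 2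
    -- Here the vertex is `p = -9/10 s²`, which reaches the endpoint `-s` at `s = 10/9`.
    rcases le_total s (10 / 9) with h4 | h4
    · have : 0 ≤ -21 / 20 * s ^ 4 + 13 / 4 * s ^ 2 - 12 / 5 * s + 12 / 25 := by
        nlinarith [sq_nonneg (s - 9 / 20), sq_nonneg (s * (s - 9 / 20)),
          mul_nonneg (sub_nonneg.2 h3) (sub_nonneg.2 h4),
          mul_nonneg (mul_nonneg (sub_nonneg.2 h3) (sub_nonneg.2 h4)) (sq_nonneg s),
          mul_nonneg (mul_nonneg (sub_nonneg.2 h3) (sub_nonneg.2 h4)) (sq_nonneg (s - 9 / 20)),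
          mul_nonneg (mul_nonneg (sub_nonneg.2 h3) (sub_nonneg.2 h4)) hs]
      nlinarith [sq_nonneg (p + 9 / 10 * s ^ 2)]
    · have h6 : 0 ≤ (p + s) * (5 * p - 5 * s + 9 * s ^ 2) :=
        mul_nonneg (by linarith) (by nlinarith)
      have : 0 ≤ 3 * s ^ 4 - 9 * s ^ 3 + 33 / 4 * s ^ 2 - 12 / 5 * s + 12 / 25 := by
        nlinarith [sq_nonneg (s ^ 2 - 3 / 2 * s + 1 / 4), sq_nonneg (s - 4 / 3)]
      nlinarith

/-- The modulus of the real part of `v` after removal of the phase of `u`. -/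
def phaseRe (u v : ℂ) : ℝ :=
  |(starRingEnd ℂ (if u = 0 then 1 else u / ‖u‖) * v).re|

/-- The part of `‖v‖` in excess of `k ‖u‖`. -/
def excess (k : ℝ) (u v : ℂ) : ℝ := max (‖v‖ - k * ‖u‖) 0

theorem phaseRe_mul_norm (u v : ℂ) (hu : u ≠ 0) :
    phaseRe u v * ‖u‖ = |(starRingEnd ℂ u * v).re| := by
  have h : starRingEnd ℂ u * v = ((‖u‖ : ℝ) : ℂ) * (starRingEnd ℂ (u / ‖u‖) * v) := by
    have : (‖u‖ : ℂ) ≠ 0 := by simpa using hu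
    simp only [map_div₀, Complex.conj_ofReal]
    field_simp
  rw [h, Complex.re_ofReal_mul, abs_mul, abs_norm, phaseRe, if_neg hu, mul_comm]

theorem norm_phase (u : ℂ) : ‖(if u = 0 then 1 else u / ‖u‖ : ℂ)‖ = 1 := by
  split_ifs with h
  · simp
  · simp [h]

theorem phaseRe_le_norm (u v : ℂ) : phaseRe u v ≤ ‖v‖ := by
  refine (Complex.abs_re_le_norm _).trans ?_
  rw [norm_mul, RCLike.norm_conj, norm_phase, one_mul]

theorem abs_phaseRe_sub_le (u v w : ℂ) : |phaseRe u v - phaseRe u w| ≤ ‖v - w‖ := by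
  refine (abs_abs_sub_abs_le_abs_sub _ _).trans ?_
  rw [← Complex.sub_re, ← mul_sub]
  exact phaseRe_le_norm u (v - w)

theorem excess_le_norm {k : ℝ} (hk : 0 ≤ k) (u v : ℂ) : excess k u v ≤ ‖v‖ :=
  max_le (by nlinarith [norm_nonneg u]) (norm_nonneg v)

theorem abs_excess_sub_le (k : ℝ) (u v w : ℂ) : |excess k u v - excess k u w| ≤ ‖v - w‖ := by
  refine (abs_max_sub_max_le_abs _ _ _).trans ?_
  rw [sub_sub_sub_cancel_right]
  exact abs_norm_sub_norm_le v w

theorem norm_add_sq_complex (u v : ℂ) :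
    ‖u + v‖ ^ 2 = ‖u‖ ^ 2 + 2 * (starRingEnd ℂ u * v).re + ‖v‖ ^ 2 := by
  rw [← Complex.normSq_eq_norm_sq, ← Complex.normSq_eq_norm_sq, ← Complex.normSq_eq_norm_sq]
  simp [Complex.normSq_apply]
  ring

/-- With `D = 1 + 2p + s² + β`, only the ratio `U / D` has to be controlled, and the sign of the
numerator decides how. Where `2p + s² ≥ 0`, `U ≥ 1 + β` and `U ≥ 3/2` give `U / D ≥ (3/2) / (3/2 +
2p + s²)`. Where both factors are nonpositive, `U / D ≥ 1`. Where the product is negative, `U ≤ 3 α₁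
≤ 3 D` gives `U / D ≤ 3`; this is where the bound of `α₂` by about `3 α₁` enters. -/
theorem curv_norm {α₁ α₂ U p s β T : ℝ} (hα : 1 / 2 ≤ α₁) (hU : U ≤ 3 * α₁) (hU' : 1 + α₂ ≤ U)
    (hβ₁ : α₁ ≤ β) (hβ₂ : β ≤ α₂) (hs : 0 ≤ s) (hp : |p| ≤ s) (hT : s - 2 / 5 ≤ T) :
    p ^ 2 - s ^ 2 / 4 - 3 * T ^ 2
      ≤ U * ((2 * p + s ^ 2) * (p + s ^ 2) / (1 + 2 * p + s ^ 2 + β)) := by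
  have hD0 : 0 ≤ 1 + 2 * p + s ^ 2 := by nlinarith [sq_nonneg (1 - s), (abs_le.1 hp).1]
  have hD : 0 < 1 + 2 * p + s ^ 2 + β := by linarith
  rw [← mul_div_assoc, le_div_iff₀ hD]
  rcases le_total 0 (2 * p + s ^ 2) with h | h
  · have h1 := curv_norm_pos hs hp h hT
    rcases le_total (p ^ 2 - s ^ 2 / 4 - 3 * T ^ 2) 0 with hm | hm
    · refine (mul_nonpos_of_nonpos_of_nonneg hm hD.le).trans ?_
      have : 0 ≤ p + s ^ 2 := by nlinarith [sq_nonneg s]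
      have : 0 ≤ U := by linarith
      positivity
    · have h2 : 3 / 2 * (1 + 2 * p + s ^ 2 + β) ≤ U * (3 / 2 + (2 * p + s ^ 2)) := by nlinarith
      nlinarith [mul_le_mul_of_nonneg_left h2 hm, mul_le_mul_of_nonneg_left h1
        (by linarith : 0 ≤ U)]
  · rcases le_total (p + s ^ 2) 0 with h' | h'
    · have h1 := curv_norm_mid hs hp h' hT
      have h2 : 0 ≤ (2 * p + s ^ 2) * (p + s ^ 2) := mul_nonneg_of_nonpos_of_nonpos h h'
      nlinarith [mul_le_mul_of_nonneg_right h1 hD.le,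
        mul_le_mul_of_nonneg_left (by linarith : 1 + 2 * p + s ^ 2 + β ≤ U) h2]
    · have h1 := curv_norm_neg hs hp h hT
      have h2 : (2 * p + s ^ 2) * (p + s ^ 2) ≤ 0 := mul_nonpos_of_nonpos_of_nonneg h h'
      nlinarith [mul_le_mul_of_nonneg_right h1 hD.le,
        mul_le_mul_of_nonpos_left (by linarith : U ≤ 3 * (1 + 2 * p + s ^ 2 + β)) h2]

/-- The contribution of one measurement to the curvature `Re ⟨∇f(x + h), h⟩`, with `u = a* x` and
`v = a* h`. -/
def curvTerm (u v : ℂ) (b : ℝ) : ℝ :=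
  (1 - (‖u‖ ^ 2 + b) / (‖u + v‖ ^ 2 + b)) * ((starRingEnd ℂ u * v).re + ‖v‖ ^ 2)

/-- Both sides are homogeneous, so dividing by `|u|²` reduces this to `curv_norm`. The minorant is
free of `b`, which is what makes the final bound uniform over `b`. -/
theorem le_curvTerm {α₁ α₂ U : ℝ} (hα : 1 / 2 ≤ α₁) (hα' : α₁ ≤ α₂) (hU : U ≤ 3 * α₁) (hU' : 1 + α₂ ≤ U)
    {u v : ℂ} {b : ℝ} (hb₁ : α₁ * ‖u‖ ^ 2 ≤ b) (hb₂ : b ≤ α₂ * ‖u‖ ^ 2) :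
    phaseRe u v ^ 2 - ‖v‖ ^ 2 / 4 - 3 * excess (2 / 5) u v ^ 2 ≤ U * curvTerm u v b := by
  -- At `u = 0` also `b = 0`, the term equals `|v|²`, and the excess is all of `|v|`, so the
  -- minorant is nonpositive.
  rcases eq_or_ne u 0 with rfl | hu
  · have hb : b = 0 := by simp at hb₁ hb₂; linarith
    have h1 : phaseRe 0 v ^ 2 ≤ ‖v‖ ^ 2 := by
      have := phaseRe_le_norm 0 v
      have h0 : 0 ≤ phaseRe 0 v := abs_nonneg _
      gcongr
    have h2 : excess (2 / 5) 0 v = ‖v‖ := by simp [excess]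
    have h3 : curvTerm 0 v b = ‖v‖ ^ 2 := by simp [curvTerm, hb]
    rw [h2, h3]
    nlinarith [mul_nonneg (by linarith : 0 ≤ U) (sq_nonneg ‖v‖), sq_nonneg ‖v‖]
  · have hY : 0 < ‖u‖ := norm_pos_iff.2 hu
    set R := (starRingEnd ℂ u * v).re with hR
    have hRle : |R| ≤ ‖u‖ * ‖v‖ := by
      refine (Complex.abs_re_le_norm _).trans ?_
      rw [norm_mul, RCLike.norm_conj]
    have key := curv_norm (p := R / ‖u‖ ^ 2) (s := ‖v‖ / ‖u‖) (β := b / ‖u‖ ^ 2)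
      (T := excess (2 / 5) u v / ‖u‖) hα hU hU' (by rwa [le_div_iff₀ (by positivity)])
      (by rwa [div_le_iff₀ (by positivity)]) (by positivity)
      (by
        rw [abs_div, abs_of_pos (by positivity : 0 < ‖u‖ ^ 2),
          div_le_div_iff₀ (by positivity) hY]
        nlinarith)
      (by
        rw [le_div_iff₀ hY, sub_mul, div_mul_cancel₀ _ hY.ne']
        exact le_max_left _ _)
    have hph : phaseRe u v ^ 2 = (R / ‖u‖ ^ 2) ^ 2 * ‖u‖ ^ 2 := by
      have h1 := phaseRe_mul_norm u v hu
      have h2 : phaseRe u v ^ 2 * ‖u‖ ^ 2 = R ^ 2 := by rw [← mul_pow, h1, sq_abs]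
      field_simp
      linarith
    have hb0 : 0 < ‖u + v‖ ^ 2 + b := by
      have : 0 < α₁ * ‖u‖ ^ 2 := by positivity
      nlinarith [sq_nonneg ‖u + v‖]
    have hsq := norm_add_sq_complex u v
    rw [← hR] at hsq
    have hct : curvTerm u v b = ‖u‖ ^ 2 * ((2 * (R / ‖u‖ ^ 2) + (‖v‖ / ‖u‖) ^ 2)
        * (R / ‖u‖ ^ 2 + (‖v‖ / ‖u‖) ^ 2)
        / (1 + 2 * (R / ‖u‖ ^ 2) + (‖v‖ / ‖u‖) ^ 2 + b / ‖u‖ ^ 2)) := by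
      have e1 : 1 + 2 * (R / ‖u‖ ^ 2) + (‖v‖ / ‖u‖) ^ 2 + b / ‖u‖ ^ 2
          = (‖u + v‖ ^ 2 + b) / ‖u‖ ^ 2 := by
        rw [hsq]; field_simp
      rw [e1, curvTerm, ← hR]
      rw [one_sub_div hb0.ne']
      have e2 : ‖u + v‖ ^ 2 + b - (‖u‖ ^ 2 + b) = 2 * R + ‖v‖ ^ 2 := by rw [hsq]; ring
      rw [e2]
      field_simp
    have h4 := mul_le_mul_of_nonneg_left key (sq_nonneg ‖u‖)
    rw [hct, hph]
    calc _ = ‖u‖ ^ 2 * ((R / ‖u‖ ^ 2) ^ 2 - (‖v‖ / ‖u‖) ^ 2 / 4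
          - 3 * (excess (2 / 5) u v / ‖u‖) ^ 2) := by field_simp
      _ ≤ _ := h4
      _ = _ := by ring

/-! ### Pointwise upper bound for the gradient. -/

/-- Bound on the contribution of one measurement to the gradient. -/
theorem norm_grad_coeff_le {α₁ : ℝ} (hα : 0 < α₁) {u v : ℂ} {b : ℝ}
    (hb : α₁ * ‖u‖ ^ 2 ≤ b) :
    ‖((1 - (‖u‖ ^ 2 + b) / (‖u + v‖ ^ 2 + b) : ℝ) : ℂ) * (u + v)‖
      ≤ (1 + 1 / (2 * Real.sqrt α₁)) * ‖v‖ := by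
  set w := u + v with hw
  have hs : 0 < Real.sqrt α₁ := Real.sqrt_pos.2 hα
  have hss : Real.sqrt α₁ ^ 2 = α₁ := Real.sq_sqrt hα.le
  have hb0 : 0 ≤ b := le_trans (by positivity) hb
  rcases eq_or_ne w 0 with h0 | h0
  · rw [h0]; simp; positivity
  · have hW : 0 < ‖w‖ := norm_pos_iff.2 h0
    have hD : 0 < ‖w‖ ^ 2 + b := by positivity
    rw [norm_mul, Complex.norm_real, Real.norm_eq_abs, one_sub_div hD.ne', abs_div,
      abs_of_pos hD, div_mul_eq_mul_div, div_le_iff₀ hD]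
    have h1 : |‖w‖ ^ 2 + b - (‖u‖ ^ 2 + b)| ≤ ‖v‖ * (‖w‖ + ‖u‖) := by
      have e : ‖w‖ ^ 2 + b - (‖u‖ ^ 2 + b) = (‖w‖ - ‖u‖) * (‖w‖ + ‖u‖) := by ring
      rw [e, abs_mul, abs_of_nonneg (by positivity : 0 ≤ ‖w‖ + ‖u‖)]
      gcongr
      calc |‖w‖ - ‖u‖| ≤ ‖w - u‖ := abs_norm_sub_norm_le _ _
        _ = ‖v‖ := by rw [hw]; congr 1; ring
    have h2 : (‖w‖ + ‖u‖) * ‖w‖ ≤ (1 + 1 / (2 * Real.sqrt α₁)) * (‖w‖ ^ 2 + b) := by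
      -- AM-GM for `|w|` and `√α₁ |u|`, followed by `α₁ |u|² ≤ b`.
      have h3 : ‖w‖ * ‖u‖ ≤ 1 / (2 * Real.sqrt α₁) * (‖w‖ ^ 2 + b) := by
        rw [div_mul_eq_mul_div, le_div_iff₀ (by positivity), one_mul]
        nlinarith [sq_nonneg (‖w‖ - Real.sqrt α₁ * ‖u‖)]
      nlinarith
    calc |‖w‖ ^ 2 + b - (‖u‖ ^ 2 + b)| * ‖w‖ ≤ ‖v‖ * (‖w‖ + ‖u‖) * ‖w‖ := by gcongr
      _ = ‖v‖ * ((‖w‖ + ‖u‖) * ‖w‖) := by ring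
      _ ≤ ‖v‖ * ((1 + 1 / (2 * Real.sqrt α₁)) * (‖w‖ ^ 2 + b)) := by gcongr
      _ = _ := by ring

/-! ### Distance up to phase and equivariance of the gradient. -/

theorem phaseDist_le {n : ℕ} (x z : EuclideanSpace ℂ (Fin n)) {c : ℂ} (hc : ‖c‖ = 1) :
    phaseDist x z ≤ ‖c • x - z‖ := by
  have hmem := toIcoMod_mem_Ico Real.two_pi_pos 0 c.arg
  rw [zero_add] at hmem
  have he : Complex.exp (Complex.I * ((toIcoMod Real.two_pi_pos 0 c.arg : ℝ) : ℂ)) = c := by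
    have h1 : Complex.exp (c.arg * Complex.I) = c := by
      have := Complex.norm_mul_exp_arg_mul_I c
      rwa [hc, Complex.ofReal_one, one_mul] at this
    conv_rhs => rw [← h1]
    rw [Complex.exp_eq_exp_iff_exists_int]
    refine ⟨-toIcoDiv Real.two_pi_pos 0 c.arg, ?_⟩
    rw [← self_sub_toIcoDiv_zsmul]
    push_cast [zsmul_eq_mul]
    ring
  refine (ciInf_le ⟨0, ?_⟩ (⟨_, hmem⟩ : Set.Ico (0 : ℝ) (2 * Real.pi))).trans_eq ?_
  · rintro _ ⟨θ, rfl⟩; exact norm_nonneg _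
  · simp only [he]

theorem exists_phaseDist_eq_norm {n : ℕ} (x z : EuclideanSpace ℂ (Fin n)) :
    ∃ c : ℂ, ‖c‖ = 1 ∧ phaseDist x z = ‖c • x - z‖ := by
  obtain ⟨φ, -, h⟩ := exists_phaseDist_eq x z
  exact ⟨_, by rw [mul_comm]; exact Complex.norm_exp_ofReal_mul_I φ, h⟩

theorem norm_smul_sub_eq {n : ℕ} (x z : EuclideanSpace ℂ (Fin n)) {c : ℂ} (hc : ‖c‖ = 1) :
    ‖c • x - z‖ = ‖starRingEnd ℂ c • z - x‖ := by
  have h : starRingEnd ℂ c * c = 1 := by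
    rw [mul_comm, Complex.mul_conj, Complex.normSq_eq_norm_sq, hc]; simp
  have : starRingEnd ℂ c • z - x = -(starRingEnd ℂ c • (c • x - z)) := by
    rw [smul_sub, smul_smul, h, one_smul, neg_sub]
  rw [this, norm_neg, norm_smul, RCLike.norm_conj, hc, one_mul]

theorem phaseDist_comm {n : ℕ} (x z : EuclideanSpace ℂ (Fin n)) :
    phaseDist x z = phaseDist z x := by
  have key : ∀ x z : EuclideanSpace ℂ (Fin n), phaseDist z x ≤ phaseDist x z := by
    intro x z
    obtain ⟨c, hc, h⟩ := exists_phaseDist_eq_norm x z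
    rw [h, norm_smul_sub_eq x z hc]
    exact phaseDist_le z x (by rwa [RCLike.norm_conj])
  exact le_antisymm (key z x) (key x z)

theorem phaseDist_nonneg {n : ℕ} (x z : EuclideanSpace ℂ (Fin n)) : 0 ≤ phaseDist x z := by
  obtain ⟨c, -, h⟩ := exists_phaseDist_eq_norm x z
  rw [h]; positivity

/-- An optimal phase rotates `z` so that `⟨x, z - x⟩` is real. -/
theorem exists_aligned {n : ℕ} (x z : EuclideanSpace ℂ (Fin n)) :
    ∃ c : ℂ, ‖c‖ = 1 ∧ phaseDist z x = ‖c • z - x‖ ∧ (inner ℂ x (c • z - x)).im = 0 := by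
  obtain ⟨c, hc, h⟩ := exists_phaseDist_eq_norm z x
  refine ⟨c, hc, h, ?_⟩
  have hmin : ∀ d : ℂ, ‖d‖ = 1 → (d * inner ℂ x z).re ≤ (c * inner ℂ x z).re := by
    intro d hd
    have h1 := phaseDist_le z x hd
    rw [h] at h1
    have h2 := pow_le_pow_left₀ (norm_nonneg _) h1 2
    have e : ∀ d : ℂ, ‖d‖ = 1 →
        ‖d • z - x‖ ^ 2 = ‖z‖ ^ 2 - 2 * (d * inner ℂ x z).re + ‖x‖ ^ 2 := by
      intro d hd
      rw [@norm_sub_sq ℂ, norm_smul, hd, one_mul, inner_re_symm, inner_smul_right]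
      rfl
    rw [e d hd, e c hc] at h2
    linarith
  have himx : (inner ℂ x x : ℂ).im = 0 := inner_self_im (𝕜 := ℂ) x
  rw [inner_sub_right, Complex.sub_im, himx, sub_zero, inner_smul_right]
  set y : ℂ := c * inner ℂ x z with hy
  rcases eq_or_ne y 0 with h0 | h0
  · rw [h0]; rfl
  · have hn : 0 < ‖y‖ := norm_pos_iff.2 h0
    -- Test optimality against the further rotation that makes `⟨x, c z⟩` real and nonnegative: its
    -- real part cannot exceed that of `y`, so `y` already equals its modulus.
    have h1 := hmin (starRingEnd ℂ y / ‖y‖ * c) (by simp [hc, h0])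
    have h2 : starRingEnd ℂ y / ‖y‖ * c * inner ℂ x z = ((‖y‖ : ℝ) : ℂ) := by
      have : (‖y‖ : ℂ) ≠ 0 := by simpa using h0
      rw [mul_assoc, ← hy, div_mul_eq_mul_div, mul_comm, Complex.mul_conj,
        Complex.normSq_eq_norm_sq]
      push_cast
      field_simp
    rw [h2, Complex.ofReal_re] at h1
    have h3 : y.re = ‖y‖ := le_antisymm (Complex.re_le_norm y) h1
    exact (Complex.nonneg_iff.1 (Complex.re_eq_norm.1 h3)).2.symm

theorem grad_smul {n m : ℕ} (a : Fin m → EuclideanSpace ℂ (Fin n)) (b y : Fin m → ℝ)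
    (z : EuclideanSpace ℂ (Fin n)) {c : ℂ} (hc : ‖c‖ = 1) :
    grad a b y (c • z) = c • grad a b y z := by
  simp only [grad, inner_smul_right, norm_mul, hc, one_mul]
  rw [smul_comm c, Finset.smul_sum (r := c)]
  refine congrArg (fun v : EuclideanSpace ℂ (Fin n) => (1 / (m : ℂ)) • v) ?_
  refine Finset.sum_congr rfl fun j _ => ?_
  rw [smul_smul]
  congr 1
  ring

/-! ### Regularity condition and contraction. -/

theorem re_inner_grad {n m : ℕ} (a : Fin m → EuclideanSpace ℂ (Fin n)) (b : Fin m → ℝ)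
    (x h : EuclideanSpace ℂ (Fin n)) :
    (inner ℂ h (grad a b (data a b x) (x + h))).re
      = (1 / (m : ℝ)) * ∑ j, curvTerm (inner ℂ (a j) x) (inner ℂ (a j) h) (b j) := by
  have hm : (1 / (m : ℂ)) = ((1 / (m : ℝ) : ℝ) : ℂ) := by push_cast; rfl
  rw [grad, inner_smul_right, hm, Complex.re_ofReal_mul, inner_sum, Complex.re_sum]
  congr 1
  refine Finset.sum_congr rfl fun j _ => ?_
  rw [inner_smul_right, curvTerm, data, mul_assoc, Complex.re_ofReal_mul, inner_add_right,
    ← inner_conj_symm h (a j)]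
  congr 1
  generalize (inner ℂ (a j) x : ℂ) = u
  generalize (inner ℂ (a j) h : ℂ) = v
  rw [← Complex.normSq_eq_norm_sq]
  simp [Complex.normSq_apply]
  ring

/-- Duality: `‖g‖² = ⟨g, g⟩` is at most the mean of `κ |a* h| |a* g|`. Cauchy–Schwarz and the
second-moment bound, used for both `h` and `g`, leave one factor `‖g‖` to cancel. -/
theorem norm_grad_le {n m : ℕ} {a : Fin m → EuclideanSpace ℂ (Fin n)} {b : Fin m → ℝ}
    {x : EuclideanSpace ℂ (Fin n)} {α₁ M : ℝ} (hα : 0 < α₁) (hM : 0 ≤ M)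
    (hb : ∀ j, α₁ * ‖inner ℂ (a j) x‖ ^ 2 ≤ b j)
    (ha : ∀ h, (1 / (m : ℝ)) * ∑ j, ‖inner ℂ (a j) h‖ ^ 2 ≤ M * ‖h‖ ^ 2)
    (h : EuclideanSpace ℂ (Fin n)) :
    ‖grad a b (data a b x) (x + h)‖ ≤ (1 + 1 / (2 * Real.sqrt α₁)) * M * ‖h‖ := by
  set g := grad a b (data a b x) (x + h) with hg
  set κ := 1 + 1 / (2 * Real.sqrt α₁) with hκ
  have hκ0 : 0 ≤ κ := by positivity
  have h1 : ‖g‖ ^ 2 ≤ (1 / (m : ℝ)) * ∑ j, κ * ‖inner ℂ (a j) h‖ * ‖inner ℂ (a j) g‖ := by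
    have e : ‖g‖ ^ 2 = ‖inner ℂ g g‖ := by rw [inner_self_eq_norm_sq_to_K]; simp
    rw [e]
    nth_rewrite 2 [hg]
    rw [grad, inner_smul_right, norm_mul, inner_sum]
    have : ‖(1 / (m : ℂ))‖ = 1 / (m : ℝ) := by simp
    rw [this]
    gcongr
    refine (norm_sum_le _ _).trans (Finset.sum_le_sum fun j _ => ?_)
    rw [inner_smul_right, norm_mul, norm_inner_symm g (a j)]
    gcongr
    rw [data, inner_add_right]
    exact norm_grad_coeff_le hα (hb j)
  have h2 : ((1 / (m : ℝ)) * ∑ j, κ * ‖inner ℂ (a j) h‖ * ‖inner ℂ (a j) g‖) ^ 2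
      ≤ κ ^ 2 * (M * ‖h‖ ^ 2) * (M * ‖g‖ ^ 2) := by
    have cs := Finset.sum_mul_sq_le_sq_mul_sq Finset.univ (fun j => ‖inner ℂ (a j) h‖)
      (fun j => ‖inner ℂ (a j) g‖)
    have e : ((1 / (m : ℝ)) * ∑ j, κ * ‖inner ℂ (a j) h‖ * ‖inner ℂ (a j) g‖)
        = κ * ((1 / (m : ℝ)) * ∑ j, ‖inner ℂ (a j) h‖ * ‖inner ℂ (a j) g‖) := by
      simp only [mul_assoc, Finset.mul_sum]
      exact Finset.sum_congr rfl fun _ _ => by ring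
    rw [e, mul_pow, mul_assoc]
    gcongr
    calc _ = (1 / (m : ℝ)) ^ 2 * (∑ j, ‖inner ℂ (a j) h‖ * ‖inner ℂ (a j) g‖) ^ 2 := by ring
      _ ≤ (1 / (m : ℝ)) ^ 2
          * ((∑ j, ‖inner ℂ (a j) h‖ ^ 2) * ∑ j, ‖inner ℂ (a j) g‖ ^ 2) := by gcongr
      _ = ((1 / (m : ℝ)) * ∑ j, ‖inner ℂ (a j) h‖ ^ 2)
          * ((1 / (m : ℝ)) * ∑ j, ‖inner ℂ (a j) g‖ ^ 2) := by ring
      _ ≤ _ := mul_le_mul (ha h) (ha g) (by positivity) (by positivity)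
  have h3 : (‖g‖ ^ 2) ^ 2 ≤ (κ * M * ‖h‖ * ‖g‖) ^ 2 :=
    (pow_le_pow_left₀ (by positivity) h1 2).trans (h2.trans_eq (by ring))
  have h4 : ‖g‖ ^ 2 ≤ κ * M * ‖h‖ * ‖g‖ := le_of_sq_le_sq h3 (by positivity)
  rcases (norm_nonneg g).eq_or_lt with h0 | h0
  · rw [← h0]; positivity
  · nlinarith

/-- One step of Wirtinger Flow contracts under the regularity condition. -/
theorem wf_step_of_regular {n : ℕ} {h g : EuclideanSpace ℂ (Fin n)} {l u μ : ℝ} (hμ : 0 ≤ μ)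
    (hl : l * ‖h‖ ^ 2 ≤ (inner ℂ h g).re) (hu : ‖g‖ ≤ u * ‖h‖) :
    ‖h - (μ : ℂ) • g‖ ^ 2 ≤ (1 - rate l u μ) * ‖h‖ ^ 2 := by
  have h1 : ‖g‖ ^ 2 ≤ u ^ 2 * ‖h‖ ^ 2 := by
    rw [← mul_pow]; exact pow_le_pow_left₀ (norm_nonneg _) hu 2
  have e : ‖h - (μ : ℂ) • g‖ ^ 2 = ‖h‖ ^ 2 - 2 * (μ * (inner ℂ h g).re) + μ ^ 2 * ‖g‖ ^ 2 := by
    rw [@norm_sub_sq ℂ, inner_smul_right, norm_smul]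
    simp [mul_pow]
  rw [e, rate]
  nlinarith [mul_le_mul_of_nonneg_left hl hμ, mul_le_mul_of_nonneg_left h1 (sq_nonneg μ)]

/-- Linear convergence, given the uniform bounds on the measurement vectors. -/
theorem phaseDist_wf_le {n m : ℕ} {a : Fin m → EuclideanSpace ℂ (Fin n)} {b : Fin m → ℝ}
    {x : EuclideanSpace ℂ (Fin n)} {α₁ α₂ U ρ κ M l μ : ℝ} (hα : 1 / 2 ≤ α₁) (hα' : α₁ ≤ α₂)
    (hU : U ≤ 3 * α₁) (hU' : 1 + α₂ ≤ U) (hM : 0 ≤ M) (hμ : 0 ≤ μ)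
    (hr0 : 0 ≤ rate l ((1 + 1 / (2 * Real.sqrt α₁)) * M) μ)
    (hr1 : rate l ((1 + 1 / (2 * Real.sqrt α₁)) * M) μ ≤ 1)
    (hl : U * l ≤ κ)
    (hb : ∀ j, α₁ * ‖inner ℂ (a j) x‖ ^ 2 ≤ b j ∧ b j ≤ α₂ * ‖inner ℂ (a j) x‖ ^ 2)
    (ha : ∀ h, (1 / (m : ℝ)) * ∑ j, ‖inner ℂ (a j) h‖ ^ 2 ≤ M * ‖h‖ ^ 2)
    (hc : ∀ h, (inner ℂ x h).im = 0 → ‖h‖ ≤ ρ * ‖x‖ →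
      κ * ‖h‖ ^ 2 ≤ (1 / (m : ℝ)) * ∑ j, (phaseRe (inner ℂ (a j) x) (inner ℂ (a j) h) ^ 2
        - ‖inner ℂ (a j) h‖ ^ 2 / 4
        - 3 * excess (2 / 5) (inner ℂ (a j) x) (inner ℂ (a j) h) ^ 2))
    {z₀ : EuclideanSpace ℂ (Fin n)} (hz₀ : z₀ ∈ nbhd x ρ) (k : ℕ) :
    phaseDist (wf a b (data a b x) μ z₀ k) x ^ 2
      ≤ (1 - rate l ((1 + 1 / (2 * Real.sqrt α₁)) * M) μ) ^ k * phaseDist z₀ x ^ 2 := by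
  set u := (1 + 1 / (2 * Real.sqrt α₁)) * M with hu
  have hstep : ∀ z, phaseDist z x ≤ ρ * ‖x‖ →
      phaseDist (z - (μ : ℂ) • grad a b (data a b x) z) x ^ 2
        ≤ (1 - rate l u μ) * phaseDist z x ^ 2 := by
    intro z hz
    obtain ⟨c, hc1, hd, him⟩ := exists_aligned x z
    set h := c • z - x with hh
    have hcz : c • z = x + h := by rw [hh]; abel
    set g := grad a b (data a b x) (x + h) with hg
    have hcg : c • grad a b (data a b x) z = g := by rw [← grad_smul _ _ _ _ hc1, hcz]
    have h1 : phaseDist (z - (μ : ℂ) • grad a b (data a b x) z) x ≤ ‖h - (μ : ℂ) • g‖ := by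
      refine (phaseDist_le _ _ hc1).trans_eq ?_
      rw [smul_sub, smul_comm, hcg, hcz]
      congr 1
      abel
    have hreg : l * ‖h‖ ^ 2 ≤ (inner ℂ h g).re := by
      have h2 := hc h him (by rw [← hd]; exact hz)
      have h3 : (1 / (m : ℝ)) * ∑ j, (phaseRe (inner ℂ (a j) x) (inner ℂ (a j) h) ^ 2
          - ‖inner ℂ (a j) h‖ ^ 2 / 4
          - 3 * excess (2 / 5) (inner ℂ (a j) x) (inner ℂ (a j) h) ^ 2)
          ≤ U * (inner ℂ h g).re := by
        rw [hg, re_inner_grad, mul_left_comm, Finset.mul_sum (a := U)]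
        refine mul_le_mul_of_nonneg_left (Finset.sum_le_sum fun j _ => ?_) (by positivity)
        exact le_curvTerm hα hα' hU hU' (hb j).1 (hb j).2
      have hU0 : 0 < U := by linarith
      have h4 : U * (l * ‖h‖ ^ 2) ≤ U * (inner ℂ h g).re := by
        rw [← mul_assoc]
        exact (mul_le_mul_of_nonneg_right hl (sq_nonneg _)).trans (h2.trans h3)
      exact le_of_mul_le_mul_left h4 hU0
    have hgr : ‖g‖ ≤ u * ‖h‖ := norm_grad_le (by linarith) hM (fun j => (hb j).1) ha h
    rw [hd]
    exact (pow_le_pow_left₀ (phaseDist_nonneg _ _) h1 2).trans (wf_step_of_regular hμ hreg hgr)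
  have hz0 : phaseDist z₀ x ≤ ρ * ‖x‖ := by rw [phaseDist_comm]; exact hz₀
  induction k with
  | zero => simp [wf]
  | succ k ih =>
    -- The distance has not grown, so the current iterate is still in the neighbourhood where the
    -- curvature bound holds.
    have hk : phaseDist (wf a b (data a b x) μ z₀ k) x ≤ phaseDist z₀ x := by
      refine le_of_sq_le_sq (ih.trans ?_) (phaseDist_nonneg _ _)
      exact mul_le_of_le_one_left (sq_nonneg _) (pow_le_one₀ (by linarith) (by linarith))
    calc _ ≤ _ := hstep _ (hk.trans hz0)
      _ ≤ (1 - rate l u μ) * ((1 - rate l u μ) ^ k * phaseDist z₀ x ^ 2) :=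
        mul_le_mul_of_nonneg_left ih (by linarith)
      _ = _ := by ring

/-! ### Arithmetic of the admissible parameters. -/

theorem rhoOne_bounds : 0.11118 < rhoOne ∧ rhoOne < 0.1112 := by
  have h1 : 275.7 < Real.sqrt 76015 := Real.lt_sqrt_of_sq_lt (by norm_num)
  have h2 : Real.sqrt 76015 < 275.72 := (Real.sqrt_lt' (by norm_num)).2 (by norm_num)
  constructor <;> rw [rhoOne] <;> norm_num <;> linarith

/-- `ρ₁` is the point where the margin of `curvature_margin_three`, taken at `U / α₁ = 3`, vanishes.
-/
theorem rhoOne_quadratic : 92 - 552 * rhoOne - 2477 * rhoOne ^ 2 = 0 := by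
  have h := Real.sq_sqrt (show (0 : ℝ) ≤ 76015 by norm_num)
  rw [rhoOne]
  linear_combination (-4 / 2477) * h

theorem rhoTwo_lt : rhoTwo < 0.16334 := by
  have h2 : Real.sqrt 39 < 6.24501 := (Real.sqrt_lt' (by norm_num)).2 (by norm_num)
  rw [rhoTwo]; norm_num; linarith

/-- `t₂` is the value of `τ` at which the margin vanishes for `ρ = 1/6`. The line in `Admissible` is
thus the chord of the zero curve through `(ρ₁, 3)` and `(1/6, t₂)`; the numerical bounds below are
enough to place it on the favourable side. -/
theorem tTwo_bounds : 1.3295 < tTwo ∧ tTwo < 1.3298 := by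
  have h1 : 6758.5 < Real.sqrt 45678865 := Real.lt_sqrt_of_sq_lt (by norm_num)
  have h2 : Real.sqrt 45678865 < 6758.7 := (Real.sqrt_lt' (by norm_num)).2 (by norm_num)
  constructor <;> rw [tTwo] <;> norm_num <;> linarith

/-- Up to the factor `119 - 9κ`, the value of `32 U (φ₁ + φ₂ - φ)` on the boundary, as a function of
`κ = U / α₁`. -/
theorem curvature_margin_line {ρ : ℝ} (h1 : rhoOne < ρ) (h2 : ρ ≤ rhoTwo) {τ : ℝ}
    (hτ : τ = 3 - (3 - tTwo) * (ρ - rhoOne) / (1 / 6 - rhoOne)) :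
    τ ≤ 3 ∧ 648 * ρ ^ 2 ≤
      (17 / 32 - 3 / 2 * ρ + ρ ^ 2 / 2 - 3 * τ / 32 - ρ ^ 2 * τ / 16) * (119 - 9 * τ) := by
  obtain ⟨hr1, hr2⟩ := rhoOne_bounds
  obtain ⟨ht1, ht2⟩ := tTwo_bounds
  have hq := rhoOne_quadratic
  have h2' := h2.trans_lt rhoTwo_lt
  set r := rhoOne
  obtain ⟨e, rfl⟩ : ∃ e, ρ = r + e := ⟨ρ - r, by ring⟩
  have he0 : 0 < e := by linarith
  have he1 : e < 0.05216 := by linarith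
  have hd : 0 < 1 / 6 - r := by linarith
  obtain ⟨l, hl⟩ : ∃ l, l = (3 - tTwo) / (1 / 6 - r) := ⟨_, rfl⟩
  have hl1 : 30.09 < l := by rw [hl, lt_div_iff₀ hd]; linarith
  have hl2 : l < 30.13 := by rw [hl, div_lt_iff₀ hd]; linarith
  have hτ' : τ = 3 - l * e := by rw [hτ, hl]; ring
  rw [hτ']
  refine ⟨by nlinarith, ?_⟩
  -- `B` is the increment of the first factor divided by `e`. The margin is zero at `e = 0`, so it
  -- equals `e` times the expression in `key`.
  obtain ⟨B, hB⟩ : ∃ B, B = 3 * l / 32 - 3 / 2 + 5 / 16 * (2 * r + e) + l * (r + e) ^ 2 / 16 :=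
    ⟨_, rfl⟩
  have hre : r ^ 2 + 2 * r * e ≤ (r + e) ^ 2 := by nlinarith
  have hB1 : 1.412 + 0.72 * e ≤ B := by
    have : 30.09 * (0.11118 ^ 2 + 2 * 0.11118 * e) ≤ l * (r + e) ^ 2 := by
      refine mul_le_mul hl1.le ?_ (by nlinarith) (by linarith)
      nlinarith
    rw [hB]; nlinarith
  have key : 0 ≤ 9 * l * (162 / 23 * r ^ 2) + 92 * B + 9 * l * e * B - 1296 * r - 648 * e := by
    have k1 : 9 * 30.09 * (162 / 23 * 0.11118 ^ 2) ≤ 9 * l * (162 / 23 * r ^ 2) := by gcongr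
    have k2 : 9 * 30.09 * e * (1.412 + 0.72 * e) ≤ 9 * l * e * B := by gcongr
    nlinarith
  have := mul_nonneg he0.le key
  have hP : 1 / 4 - 3 / 2 * r + 5 / 16 * r ^ 2 = 162 / 23 * r ^ 2 := by linarith
  have e1 : (17 / 32 - 3 / 2 * (r + e) + (r + e) ^ 2 / 2 - 3 * (3 - l * e) / 32
      - (r + e) ^ 2 * (3 - l * e) / 16) = 162 / 23 * r ^ 2 + e * B := by
    rw [hB, ← hP]; ring
  rw [e1]
  nlinarith

/-- The same margin where `U < 3 α₁` is the only restriction. -/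
theorem curvature_margin_three {ρ : ℝ} (h0 : 0 < ρ) (h1 : ρ ≤ rhoOne) :
    648 * ρ ^ 2 ≤
      (17 / 32 - 3 / 2 * ρ + ρ ^ 2 / 2 - 3 * 3 / 32 - ρ ^ 2 * 3 / 16) * (119 - 9 * 3) := by
  have hq := rhoOne_quadratic
  have : ρ ^ 2 ≤ rhoOne ^ 2 := by gcongr
  nlinarith

/-- Both branches are put into one form with slope `τ ≤ 3`. The bound `1/2 ≤ α₁` follows from `(1 +
ρ)² + α₁ ≤ U ≤ 3 α₁`. -/
theorem Admissible.bounds {α₁ α₂ ρ : ℝ} (h : Admissible α₁ α₂ ρ) :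
    0 < ρ ∧ ρ < 0.16334 ∧ 1 / 2 ≤ α₁ ∧ α₁ ≤ α₂ ∧ bigU α₂ ρ ≤ 3 * α₁ ∧ ∃ τ ≤ 3,
      bigU α₂ ρ < τ * α₁ ∧ 648 * ρ ^ 2 ≤
        (17 / 32 - 3 / 2 * ρ + ρ ^ 2 / 2 - 3 * τ / 32 - ρ ^ 2 * τ / 16) * (119 - 9 * τ) := by
  obtain ⟨h0, h12, h⟩ := h
  have hr := rhoOne_bounds
  have key : 0 < ρ ∧ ρ < 0.16334 ∧ ∃ τ ≤ 3, bigU α₂ ρ < τ * α₁ ∧ 648 * ρ ^ 2 ≤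
        (17 / 32 - 3 / 2 * ρ + ρ ^ 2 / 2 - 3 * τ / 32 - ρ ^ 2 * τ / 16) * (119 - 9 * τ) := by
    rcases h with ⟨hρ, h1, h2⟩ | ⟨h1, h2, h3⟩
    · exact ⟨hρ, by linarith, 3, le_rfl, by rw [bigU]; linarith, curvature_margin_three hρ h1⟩
    · have := curvature_margin_line h1 h2 rfl
      exact ⟨by linarith, h2.trans_lt rhoTwo_lt, _, this.1, by rw [bigU]; linarith, this.2⟩
  obtain ⟨hρ, hρ', τ, hτ, hU, hm⟩ := key
  have hU3 : bigU α₂ ρ ≤ 3 * α₁ := by nlinarith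
  refine ⟨hρ, hρ', ?_, h12, hU3, τ, hτ, hU, hm⟩
  rw [bigU] at hU3
  nlinarith

/-- Multiplying by `U` makes everything but the slack depend on `ρ` and the ratios `U / α₁`, `U /
L₁` alone. -/
theorem phi_sum_eq {α₁ α₂ ρ δ : ℝ} (h : Admissible α₁ α₂ ρ) :
    bigU α₂ ρ * (phiOne α₁ α₂ ρ δ + phiTwo α₁ α₂ ρ δ - varphi α₁ α₂ ρ)
      = 17 / 32 - 3 / 2 * ρ + ρ ^ 2 / 2 - 3 * (bigU α₂ ρ / α₁) / 32
        - ρ ^ 2 * (bigU α₂ ρ / bigL α₁ ρ) / 16 - 648 * ρ ^ 2 / (119 - 9 * (bigU α₂ ρ / α₁))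
        - bigU α₂ ρ * δ / 2 := by
  obtain ⟨hρ, hρ', hα, h12, hU3, -⟩ := h.bounds
  have hα0 : 0 < α₁ := by linarith
  have hU0 : 0 < bigU α₂ ρ := by rw [bigU]; nlinarith
  have hL0 : 0 < bigL α₁ ρ := by rw [bigL]; nlinarith [sq_nonneg (1 - ρ)]
  have hκ : bigU α₂ ρ / α₁ ≤ 3 := by rwa [div_le_iff₀ hα0]
  rw [phiOne, phiTwo, varphi]
  have e : 7 + 16 * bigU α₂ ρ * psi α₁ α₂ ρ = (119 - 9 * (bigU α₂ ρ / α₁)) / 8 := by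
    rw [psi]; field_simp; ring
  rw [e]
  have hd : (119 - 9 * (bigU α₂ ρ / α₁)) ≠ 0 := by linarith
  generalize 119 - 9 * (bigU α₂ ρ / α₁) = d at *
  generalize bigU α₂ ρ = U at *
  generalize bigL α₁ ρ = L at *
  field_simp
  ring

/-- The expression decreases in `U / α₁ < τ`, and `U / L₁ ≤ U / α₁`, so it strictly exceeds its
value with both ratios replaced by `τ`, which is nonnegative. -/
theorem phi_sum_pos {α₁ α₂ ρ : ℝ} (h : Admissible α₁ α₂ ρ) :
    0 < phiOne α₁ α₂ ρ 0 + phiTwo α₁ α₂ ρ 0 - varphi α₁ α₂ ρ := by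
  obtain ⟨hρ, hρ', hα, h12, hU3, τ, hτ, hUτ, hm⟩ := h.bounds
  have hα0 : 0 < α₁ := by linarith
  have hU0 : 0 < bigU α₂ ρ := by rw [bigU]; nlinarith
  have hL : α₁ ≤ bigL α₁ ρ := by rw [bigL]; nlinarith [sq_nonneg (1 - ρ)]
  have hκτ : bigU α₂ ρ / α₁ < τ := by rwa [div_lt_iff₀ hα0]
  have hκL : bigU α₂ ρ / bigL α₁ ρ ≤ bigU α₂ ρ / α₁ := by gcongr
  refine pos_of_mul_pos_right ?_ hU0.le
  rw [phi_sum_eq h]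
  generalize bigU α₂ ρ / α₁ = κ at *
  generalize bigU α₂ ρ / bigL α₁ ρ = κ' at *
  have hd : 0 < 119 - 9 * κ := by linarith
  have hA : 0 < 17 / 32 - 3 / 2 * ρ + ρ ^ 2 / 2 - 3 * τ / 32 - ρ ^ 2 * τ / 16 := by
    refine pos_of_mul_pos_left (lt_of_lt_of_le (by positivity) hm) (by linarith)
  have h1 : 648 * ρ ^ 2 / (119 - 9 * κ)
      ≤ 17 / 32 - 3 / 2 * ρ + ρ ^ 2 / 2 - 3 * τ / 32 - ρ ^ 2 * τ / 16 := by
    rw [div_le_iff₀ hd]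
    exact hm.trans (by gcongr)
  have h2 : ρ ^ 2 * κ' ≤ ρ ^ 2 * τ := by gcongr; linarith
  linarith

theorem lCur_pos_of_small {α₁ α₂ ρ : ℝ} (h : Admissible α₁ α₂ ρ) :
    ∃ δ₀ : ℝ, 0 < δ₀ ∧ ∀ δ : ℝ, 0 < δ → δ < δ₀ → 0 < lCur α₁ α₂ ρ δ := by
  have hS := phi_sum_pos h
  obtain ⟨hρ, hρ', hα, h12, -⟩ := h.bounds
  have hR : 0 < (2 - 3 * ρ + ρ ^ 2) / ((1 + ρ) ^ 2 + α₂) := by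
    apply div_pos <;> nlinarith
  set R := (2 - 3 * ρ + ρ ^ 2) / ((1 + ρ) ^ 2 + α₂) with hRdef
  set S := phiOne α₁ α₂ ρ 0 + phiTwo α₁ α₂ ρ 0 - varphi α₁ α₂ ρ with hSdef
  refine ⟨min (S / 8) (R / (1 + R)), lt_min (by positivity) (by positivity), fun δ h0 h1 => ?_⟩
  obtain ⟨h2, h3⟩ := lt_min_iff.1 h1
  rw [lt_div_iff₀ (by positivity)] at h3
  rw [lCur, sub_pos, lt_min_iff]
  constructor
  · have : phiOne α₁ α₂ ρ δ + phiTwo α₁ α₂ ρ δ - varphi α₁ α₂ ρ = S - δ / 2 := by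
      rw [hSdef, phiOne, phiTwo, phiOne, phiTwo]; ring
    rw [this]; linarith
  · rw [← hRdef]; nlinarith

/-- Only the first entry of the minimum is used, with `U / α₁ ≥ 1`, hence `119 - 9 U / α₁ ≤ 110`;
`0.109375` is `(17/32 - 3/32) / 4`. This shows how far the prescribed constant lies below the
curvature actually available. -/
theorem bigU_mul_lCur_le {α₁ α₂ ρ δ : ℝ} (h : Admissible α₁ α₂ ρ) (hδ : 0 < δ) :
    bigU α₂ ρ * lCur α₁ α₂ ρ δ ≤ 0.109375 - 0.375 * ρ - 1.34 * ρ ^ 2 := by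
  obtain ⟨hρ, hρ', hα, h12, hU3, -⟩ := h.bounds
  have hα0 : 0 < α₁ := by linarith
  have hU0 : 0 < bigU α₂ ρ := by rw [bigU]; nlinarith
  have hL0 : 0 < bigL α₁ ρ := by rw [bigL]; nlinarith [sq_nonneg (1 - ρ)]
  have hκ : bigU α₂ ρ / α₁ ≤ 3 := by rwa [div_le_iff₀ hα0]
  have hκ1 : 1 ≤ bigU α₂ ρ / α₁ := by rw [le_div_iff₀ hα0, bigU]; nlinarith
  have h1 : lCur α₁ α₂ ρ δ
      ≤ (phiOne α₁ α₂ ρ δ + phiTwo α₁ α₂ ρ δ - varphi α₁ α₂ ρ) / 4 := by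
    rw [lCur]; linarith [min_le_left ((phiOne α₁ α₂ ρ δ + phiTwo α₁ α₂ ρ δ - varphi α₁ α₂ ρ) / 4)
      ((2 - 3 * ρ + ρ ^ 2) / ((1 + ρ) ^ 2 + α₂) * (1 - δ))]
  have h2 := mul_le_mul_of_nonneg_left h1 hU0.le
  rw [← mul_div_assoc, phi_sum_eq h] at h2
  have h3 : 0 ≤ ρ ^ 2 * (bigU α₂ ρ / bigL α₁ ρ) := by positivity
  have h4 : 0 ≤ bigU α₂ ρ * δ := by positivity
  have h5 : 648 * ρ ^ 2 / 110 ≤ 648 * ρ ^ 2 / (119 - 9 * (bigU α₂ ρ / α₁)) := by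
    gcongr <;> linarith
  nlinarith

/-! ### Joint Gaussian law of `(a* x, a* h)`. -/

/-- The standard complex Gaussian law on `ℂ`. -/
def gaussianComplex : Measure ℂ :=
  ((gaussianReal 0 (1 / 2 : ℝ≥0)).prod (gaussianReal 0 (1 / 2 : ℝ≥0))).map
    fun p => (p.1 : ℂ) + (p.2 : ℂ) * Complex.I

theorem measurable_mk_complex :
    Measurable fun p : ℝ × ℝ => (p.1 : ℂ) + (p.2 : ℂ) * Complex.I := by fun_prop

instance : IsProbabilityMeasure gaussianComplex :=
  Measure.isProbabilityMeasure_map measurable_mk_complex.aemeasurable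

theorem charFun_gaussianComplex (t : ℂ) :
    charFun gaussianComplex t = Complex.exp (-(‖t‖ : ℂ) ^ 2 / 4) := by
  rw [charFun_apply, gaussianComplex,
    integral_map measurable_mk_complex.aemeasurable (by fun_prop)]
  have e : ∀ p : ℝ × ℝ, Complex.exp ((inner ℝ ((p.1 : ℂ) + (p.2 : ℂ) * Complex.I) t : ℝ) * Complex.I)
      = Complex.exp ((inner ℝ p.1 t.re : ℝ) * Complex.I)
        * Complex.exp ((inner ℝ p.2 t.im : ℝ) * Complex.I) := by
    intro p
    rw [← Complex.exp_add, ← add_mul, ← Complex.ofReal_add]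
    congr 3
    simp [Complex.inner, mul_comm]
  simp_rw [e]
  rw [integral_prod_mul (fun x : ℝ => Complex.exp ((inner ℝ x t.re : ℝ) * Complex.I))
    (fun x : ℝ => Complex.exp ((inner ℝ x t.im : ℝ) * Complex.I)), ← charFun_apply,
    ← charFun_apply, charFun_gaussianReal, charFun_gaussianReal, ← Complex.exp_add]
  congr 1
  have : (‖t‖ : ℂ) ^ 2 = (t.re : ℂ) ^ 2 + (t.im : ℂ) ^ 2 := by
    rw [← Complex.ofReal_pow, ← Complex.normSq_eq_norm_sq, Complex.normSq_apply]
    push_cast; ring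
  rw [this]
  push_cast
  ring

theorem complexGaussian_eq_map_pi (n : ℕ) :
    complexGaussian n = (Measure.pi fun _ : Fin n => gaussianComplex).map (WithLp.toLp 2) := by
  simp only [gaussianComplex]
  rw [← Measure.pi_map_pi (fun _ => measurable_mk_complex.aemeasurable), Measure.map_map
    (WithLp.measurable_toLp 2 _) (by fun_prop)]
  rfl

theorem charFun_complexGaussian (n : ℕ) (t : EuclideanSpace ℂ (Fin n)) :
    charFun (complexGaussian n) t = Complex.exp (-(‖t‖ : ℂ) ^ 2 / 4) := by
  rw [complexGaussian_eq_map_pi, charFun_pi]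
  simp_rw [charFun_gaussianComplex]
  rw [← Complex.exp_sum, ← Complex.ofReal_pow, EuclideanSpace.norm_sq_eq]
  congr 1
  push_cast
  rw [← Finset.sum_div, Finset.sum_neg_distrib]

theorem real_inner_euclidean {n : ℕ} (x y : EuclideanSpace ℂ (Fin n)) :
    (inner ℝ x y : ℝ) = (inner ℂ x y).re := by
  rw [PiLp.inner_apply, PiLp.inner_apply, Complex.re_sum]
  rfl

/-- The joint law of `(a* x, a* g)` for a unit vector `x` and `g` orthogonal to `x`. -/
theorem map_inner_prod_orthogonal {n : ℕ} {x g : EuclideanSpace ℂ (Fin n)} (hx : ‖x‖ = 1)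
    (hxg : inner ℂ x g = (0 : ℂ)) :
    (complexGaussian n).map (fun a => ((inner ℂ a x : ℂ), (inner ℂ a g : ℂ)))
      = gaussianComplex.prod (gaussianComplex.map fun z => ((‖g‖ : ℝ) : ℂ) * z) := by
  have hm : Measurable fun a : EuclideanSpace ℂ (Fin n) =>
    ((inner ℂ a x : ℂ), (inner ℂ a g : ℂ)) := by fun_prop
  have : IsProbabilityMeasure
      ((complexGaussian n).map (fun a => ((inner ℂ a x : ℂ), (inner ℂ a g : ℂ)))) :=
    Measure.isProbabilityMeasure_map hm.aemeasurable
  have : IsProbabilityMeasure (gaussianComplex.map fun z => ((‖g‖ : ℝ) : ℂ) * z) :=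
    Measure.isProbabilityMeasure_map (by fun_prop)
  rw [← charFun_eq_prod_iff]
  intro t
  set s₁ := (WithLp.ofLp t).1 with hs₁
  set s₂ := (WithLp.ofLp t).2 with hs₂
  have h1 : charFun (gaussianComplex.map fun z => ((‖g‖ : ℝ) : ℂ) * z) s₂
      = Complex.exp (-((‖g‖ * ‖s₂‖ : ℝ) : ℂ) ^ 2 / 4) := by
    have e : (fun z : ℂ => ((‖g‖ : ℝ) : ℂ) * z) = fun z => ‖g‖ • z := by
      ext z; simp
    rw [e, charFun_map_smul, charFun_gaussianComplex, norm_smul, norm_norm]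
  rw [h1, charFun_gaussianComplex, Measure.map_map (WithLp.measurable_toLp 2 _) hm, charFun_apply,
    integral_map (by fun_prop) (by fun_prop), ← Complex.exp_add]
  -- Pairing `(a* x, a* g)` with `(s₁, s₂)` is the real pairing of `a` with one vector, whose
  -- squared norm splits by orthogonality. The characteristic function therefore factors.
  have e : ∀ a : EuclideanSpace ℂ (Fin n),
      (inner ℝ ((WithLp.toLp 2 ∘ fun a => ((inner ℂ a x : ℂ), (inner ℂ a g : ℂ))) a) t : ℝ)
        = inner ℝ a (starRingEnd ℂ s₁ • x + starRingEnd ℂ s₂ • g) := by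
    intro a
    rw [WithLp.prod_inner_apply, real_inner_euclidean, inner_add_right, inner_smul_right,
      inner_smul_right, Complex.inner, Complex.inner, Complex.add_re]
    simp only [Function.comp_apply]
    rw [← hs₁, ← hs₂]
    generalize (inner ℂ a x : ℂ) = u
    generalize (inner ℂ a g : ℂ) = v
    simp [Complex.mul_re]
  simp_rw [e]
  rw [← charFun_apply, charFun_complexGaussian]
  congr 1
  have hn : ‖starRingEnd ℂ s₁ • x + starRingEnd ℂ s₂ • g‖ ^ 2
      = ‖s₁‖ ^ 2 + (‖g‖ * ‖s₂‖) ^ 2 := by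
    rw [@norm_add_sq ℂ, inner_smul_left, inner_smul_right, hxg, norm_smul, norm_smul, hx]
    simp; ring
  rw [← Complex.ofReal_pow, hn]
  push_cast
  ring

/-- The joint law of `(a* x, a* h)` for a unit vector `x`. -/
theorem map_inner_prod {n : ℕ} {x : EuclideanSpace ℂ (Fin n)} (h : EuclideanSpace ℂ (Fin n))
    (hx : ‖x‖ = 1) : ∃ d : ℝ, 0 ≤ d ∧ ‖(inner ℂ x h : ℂ)‖ ^ 2 + d ^ 2 = ‖h‖ ^ 2 ∧
    (complexGaussian n).map (fun a => ((inner ℂ a x : ℂ), (inner ℂ a h : ℂ)))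
      = (gaussianComplex.prod gaussianComplex).map
        fun p => (p.1, inner ℂ x h * p.1 + (d : ℂ) * p.2) := by
  set c : ℂ := inner ℂ x h with hc
  set g := h - c • x with hg
  have hxg : inner ℂ x g = (0 : ℂ) := by
    rw [hg, inner_sub_right, inner_smul_right, inner_self_eq_norm_sq_to_K, hx, ← hc]; simp
  refine ⟨‖g‖, norm_nonneg _, ?_, ?_⟩
  · have : h = c • x + g := by rw [hg]; abel
    rw [this, @norm_add_sq ℂ, inner_smul_left, hxg, norm_smul, hx]; simp
  · have h1 := map_inner_prod_orthogonal hx hxg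
    have h2 : gaussianComplex.prod (gaussianComplex.map fun z => ((‖g‖ : ℝ) : ℂ) * z)
        = (gaussianComplex.prod gaussianComplex).map fun p => (p.1, ((‖g‖ : ℝ) : ℂ) * p.2) := by
      conv_lhs => rw [← Measure.map_id (μ := gaussianComplex)]
      rw [Measure.map_prod_map _ _ measurable_id (by fun_prop)]
      simp only [Measure.map_id]
      rfl
    rw [h2] at h1
    have h3 := congrArg (Measure.map fun p : ℂ × ℂ => (p.1, c * p.1 + p.2)) h1
    rw [Measure.map_map (by fun_prop) (by fun_prop), Measure.map_map (by fun_prop) (by fun_prop)]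
      at h3
    have e : (fun a => ((inner ℂ a x : ℂ), (inner ℂ a h : ℂ)))
        = (fun p : ℂ × ℂ => (p.1, c * p.1 + p.2)) ∘ fun a => (inner ℂ a x, inner ℂ a g) := by
      ext a
      · rfl
      · simp only [Function.comp_apply]
        rw [← inner_smul_right, ← inner_add_right]
        congr 1
        rw [hg]; abel
    rw [e, h3]
    rfl

theorem map_inner_unit {n : ℕ} {x : EuclideanSpace ℂ (Fin n)} (hx : ‖x‖ = 1) :
    (complexGaussian n).map (fun a => (inner ℂ a x : ℂ)) = gaussianComplex := by
  obtain ⟨d, -, -, h⟩ := map_inner_prod x hx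
  have h1 := congrArg (Measure.map Prod.fst) h
  rw [Measure.map_map (by fun_prop) (by fun_prop), Measure.map_map (by fun_prop) (by fun_prop)]
    at h1
  have h2 : (Prod.fst ∘ fun p : ℂ × ℂ => (p.1, inner ℂ x x * p.1 + (d : ℂ) * p.2)) = Prod.fst := rfl
  rw [h2, Measure.map_fst_prod, measure_univ, one_smul] at h1
  exact h1

/-! ### Gaussian moments and integrals. -/

theorem half_ne_zero : (1 / 2 : ℝ≥0) ≠ 0 := by norm_num

theorem integral_sq_gaussianReal : ∫ x, x ^ 2 ∂gaussianReal 0 (1 / 2 : ℝ≥0) = 1 / 2 := by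
  have h := variance_fun_id_gaussianReal (μ := 0) (v := (1 / 2 : ℝ≥0))
  rw [variance_of_integral_eq_zero (by fun_prop) (by simp)] at h
  simpa using h

theorem gaussianPDFReal_half (x : ℝ) :
    gaussianPDFReal 0 (1 / 2 : ℝ≥0) x = (Real.sqrt Real.pi)⁻¹ * Real.exp (-x ^ 2) := by
  rw [gaussianPDFReal]
  congr 2
  · congr 1; push_cast; ring
  · push_cast; ring

theorem integral_pow_four_gaussianReal :
    ∫ x, x ^ 4 ∂gaussianReal 0 (1 / 2 : ℝ≥0) = 3 / 4 := by
  rw [integral_gaussianReal_eq_integral_smul half_ne_zero]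
  simp_rw [gaussianPDFReal_half, smul_eq_mul, mul_assoc]
  rw [integral_const_mul]
  have h1 : ∫ x : ℝ, Real.exp (-x ^ 2) * x ^ 4
      = 2 * ∫ x in Set.Ioi (0 : ℝ), x ^ (4 : ℝ) * Real.exp (-1 * x ^ (2 : ℝ)) := by
    rw [← integral_comp_abs (f := fun x => x ^ (4 : ℝ) * Real.exp (-1 * x ^ (2 : ℝ)))]
    congr 1 with x
    have e4 : |x| ^ (4 : ℝ) = x ^ 4 := by
      rw [show (4 : ℝ) = ((4 : ℕ) : ℝ) by norm_num, Real.rpow_natCast, Even.pow_abs (by decide)]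
    have e2 : |x| ^ (2 : ℝ) = x ^ 2 := by
      rw [show (2 : ℝ) = ((2 : ℕ) : ℝ) by norm_num, Real.rpow_natCast, sq_abs]
    rw [e4, e2, mul_comm, neg_one_mul]
  have h2 := Real.Gamma_nat_add_half 2
  have e : (((2 : ℕ) : ℝ) + 1 / 2) = (4 + 1) / 2 := by norm_num
  rw [e] at h2
  rw [h1, integral_rpow_mul_exp_neg_mul_rpow (by norm_num) (by norm_num) (by norm_num), h2]
  have hd : Nat.doubleFactorial (2 * 2 - 1) = 3 := rfl
  have : Real.sqrt Real.pi ≠ 0 := by positivity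
  rw [hd, Real.one_rpow]
  field_simp
  norm_num

theorem integrable_pow_gaussianReal (k : ℕ) :
    Integrable (fun x : ℝ => x ^ k) (gaussianReal 0 (1 / 2 : ℝ≥0)) := by
  have h := (memLp_id_gaussianReal (μ := 0) (v := (1 / 2 : ℝ≥0)) (k : ℝ≥0)).integrable_norm_pow'
  refine (integrable_norm_iff (by fun_prop)).1 ?_
  simpa using h

theorem integral_gaussianComplex (f : ℂ → ℝ) (hf : Measurable f) :
    ∫ z, f z ∂gaussianComplex
      = ∫ p : ℝ × ℝ, f ((p.1 : ℂ) + (p.2 : ℂ) * Complex.I)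
        ∂((gaussianReal 0 (1 / 2 : ℝ≥0)).prod (gaussianReal 0 (1 / 2 : ℝ≥0))) :=
  integral_map measurable_mk_complex.aemeasurable hf.aestronglyMeasurable

theorem norm_sq_mk (x y : ℝ) : ‖(x : ℂ) + (y : ℂ) * Complex.I‖ ^ 2 = x ^ 2 + y ^ 2 := by
  rw [← Complex.normSq_eq_norm_sq, Complex.normSq_add_mul_I]

theorem exists_integrable_exp_gaussianComplex :
    ∃ θ : ℝ, 0 < θ ∧ Integrable (fun z : ℂ => Real.exp (θ * ‖z‖ ^ 2)) gaussianComplex := by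
  obtain ⟨θ, h0, h⟩ := IsGaussian.exists_integrable_exp_sq (gaussianReal 0 (1 / 2 : ℝ≥0))
  refine ⟨θ, h0, ?_⟩
  rw [gaussianComplex, integrable_map_measure (by fun_prop) measurable_mk_complex.aemeasurable]
  refine (h.mul_prod h).congr (ae_of_all _ fun p => ?_)
  simp only [Function.comp_apply]
  rw [norm_sq_mk, ← Real.exp_add]
  simp [mul_add]

theorem integrable_norm_pow_gaussianComplex (k : ℕ) :
    Integrable (fun z : ℂ => ‖z‖ ^ (2 * k)) gaussianComplex := by
  obtain ⟨θ, h0, h⟩ := exists_integrable_exp_gaussianComplex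
  refine (h.const_mul (k.factorial / θ ^ k)).mono' (by fun_prop) (ae_of_all _ fun z => ?_)
  have := Real.pow_div_factorial_le_exp (θ * ‖z‖ ^ 2) (by positivity) k
  rw [Real.norm_of_nonneg (by positivity)]
  rw [div_le_iff₀ (by positivity)] at this
  rw [div_mul_eq_mul_div, le_div_iff₀ (by positivity)]
  calc _ = (θ * ‖z‖ ^ 2) ^ k := by ring
    _ ≤ _ := this.trans_eq (mul_comm _ _)

theorem integral_norm_sq_gaussianComplex : ∫ z, ‖z‖ ^ 2 ∂gaussianComplex = 1 := by
  rw [integral_gaussianComplex _ (by fun_prop)]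
  simp_rw [norm_sq_mk]
  rw [integral_add ((integrable_pow_gaussianReal 2).comp_fst _) ((integrable_pow_gaussianReal 2).comp_snd _),
    integral_fun_fst (fun x : ℝ => x ^ 2), integral_fun_snd (fun x : ℝ => x ^ 2),
    integral_sq_gaussianReal]
  simp; norm_num

theorem integral_norm_pow_four_gaussianComplex : ∫ z, ‖z‖ ^ 4 ∂gaussianComplex = 2 := by
  have i2 := integrable_pow_gaussianReal 2
  have i4 := integrable_pow_gaussianReal 4
  have e : ∀ x y : ℝ, ‖(x : ℂ) + (y : ℂ) * Complex.I‖ ^ 4 = x ^ 4 + y ^ 4 + 2 * (x ^ 2 * y ^ 2) := by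
    intro x y
    calc _ = (‖(x : ℂ) + (y : ℂ) * Complex.I‖ ^ 2) ^ 2 := by ring
      _ = _ := by rw [norm_sq_mk]; ring
  rw [integral_gaussianComplex _ (by fun_prop)]
  simp_rw [e]
  have i44 : Integrable (fun p : ℝ × ℝ => p.1 ^ 4 + p.2 ^ 4)
      ((gaussianReal 0 (1 / 2 : ℝ≥0)).prod (gaussianReal 0 (1 / 2 : ℝ≥0))) :=
    (i4.comp_fst _).add (i4.comp_snd _)
  rw [integral_add i44 ((i2.mul_prod i2).const_mul 2),
    integral_add (i4.comp_fst _) (i4.comp_snd _), integral_const_mul,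
    integral_prod_mul (fun x : ℝ => x ^ 2) (fun x : ℝ => x ^ 2),
    integral_fun_fst (fun x : ℝ => x ^ 4), integral_fun_snd (fun x : ℝ => x ^ 4),
    integral_sq_gaussianReal, integral_pow_four_gaussianReal]
  simp; norm_num

theorem integral_re_mul_gaussianComplex (ω : ℂ) : ∫ z, (ω * z).re ∂gaussianComplex = 0 := by
  have i1 : Integrable (fun x : ℝ => x) (gaussianReal 0 (1 / 2 : ℝ≥0)) := by
    simpa using integrable_pow_gaussianReal 1
  have h0 : ∫ x, x ∂gaussianReal 0 (1 / 2 : ℝ≥0) = 0 := by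
    simp
  rw [integral_gaussianComplex _ (by fun_prop)]
  have e : ∀ p : ℝ × ℝ, (ω * ((p.1 : ℂ) + (p.2 : ℂ) * Complex.I)).re
      = ω.re * p.1 - ω.im * p.2 := by
    intro p; simp
  simp_rw [e]
  rw [integral_sub ((i1.comp_fst _).const_mul _) ((i1.comp_snd _).const_mul _),
    integral_const_mul, integral_const_mul, integral_fun_fst (fun x : ℝ => x),
    integral_fun_snd (fun x : ℝ => x), h0]
  simp

theorem integral_re_mul_sq_gaussianComplex {ω : ℂ} (hω : ‖ω‖ = 1) :
    ∫ z, (ω * z).re ^ 2 ∂gaussianComplex = 1 / 2 := by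
  have i1 : Integrable (fun x : ℝ => x) (gaussianReal 0 (1 / 2 : ℝ≥0)) := by
    simpa using integrable_pow_gaussianReal 1
  have i2 := integrable_pow_gaussianReal 2
  have h0 : ∫ x, x ∂gaussianReal 0 (1 / 2 : ℝ≥0) = 0 := by
    simp
  have hω2 : ω.re ^ 2 + ω.im ^ 2 = 1 := by
    have := Complex.normSq_eq_norm_sq ω
    rw [hω, Complex.normSq_apply] at this
    linarith
  rw [integral_gaussianComplex _ (by fun_prop)]
  have e : ∀ p : ℝ × ℝ, (ω * ((p.1 : ℂ) + (p.2 : ℂ) * Complex.I)).re ^ 2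
      = ω.re ^ 2 * p.1 ^ 2 + ω.im ^ 2 * p.2 ^ 2 + (-2 * ω.re * ω.im) * (p.1 * p.2) := by
    intro p; simp; ring
  simp_rw [e]
  have i22 : Integrable (fun p : ℝ × ℝ => ω.re ^ 2 * p.1 ^ 2 + ω.im ^ 2 * p.2 ^ 2)
      ((gaussianReal 0 (1 / 2 : ℝ≥0)).prod (gaussianReal 0 (1 / 2 : ℝ≥0))) :=
    ((i2.comp_fst _).const_mul _).add ((i2.comp_snd _).const_mul _)
  rw [integral_add i22
      ((i1.mul_prod i1).const_mul _),
    integral_add ((i2.comp_fst _).const_mul _) ((i2.comp_snd _).const_mul _),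
    integral_const_mul, integral_const_mul, integral_const_mul,
    integral_prod_mul (fun x : ℝ => x) (fun x : ℝ => x), integral_fun_fst (fun x : ℝ => x ^ 2),
    integral_fun_snd (fun x : ℝ => x ^ 2), h0, integral_sq_gaussianReal]
  simp
  linarith

theorem gaussianReal_half_le :
    gaussianReal 0 (1 / 2 : ℝ≥0) ≤ ENNReal.ofReal (Real.sqrt Real.pi)⁻¹ • volume := by
  rw [gaussianReal_of_var_ne_zero _ half_ne_zero, ← withDensity_const]
  refine withDensity_mono (ae_of_all _ fun x => ENNReal.ofReal_le_ofReal ?_)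
  rw [gaussianPDFReal_half]
  refine mul_le_of_le_one_right (by positivity) (Real.exp_le_one_iff.2 ?_)
  nlinarith [sq_nonneg x]

/-- The density `exp (-|z|²) / π` is at most `1 / π`. This small-ball bound makes the excess rare.
-/
theorem gaussianComplex_le : gaussianComplex ≤ ENNReal.ofReal Real.pi⁻¹ • volume := by
  have h1 := Measure.prod_mono gaussianReal_half_le gaussianReal_half_le
  have h2 := Measure.map_mono h1 measurable_mk_complex
  refine h2.trans_eq ?_
  rw [Measure.prod_smul_left, Measure.prod_smul_right, smul_smul, ← ENNReal.ofReal_mul (by positivity),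
    ← mul_inv, Real.mul_self_sqrt Real.pi_pos.le, Measure.map_smul, ← Measure.volume_eq_prod]
  congr 1
  have h3 := Complex.volume_preserving_equiv_real_prod.symm.map_eq
  convert h3 using 2
  ext p
  exact Complex.mk_eq_add_mul_I _ _ |>.symm

/-- Replace the Gaussian by `1 / π` times Lebesgue measure and use polar coordinates: `2 ∫ y (s - k
y)² dy` over `[0, s / k]` is `s⁴ / (6 k²)`. -/
theorem integral_excess_radial_le {s k : ℝ} (hs : 0 ≤ s) (hk : 0 < k) :
    ∫ u : ℂ, max (s - k * ‖u‖) 0 ^ 2 ∂gaussianComplex ≤ s ^ 4 / (6 * k ^ 2) := by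
  have hpi : 0 < Real.pi := Real.pi_pos
  have hcont : Continuous fun u : ℂ => max (s - k * ‖u‖) 0 ^ 2 := by fun_prop
  have hint : Integrable (fun u : ℂ => max (s - k * ‖u‖) 0 ^ 2) := by
    refine hcont.integrable_of_hasCompactSupport ?_
    refine HasCompactSupport.of_support_subset_isCompact (isCompact_closedBall (0 : ℂ) (s / k)) ?_
    intro u hu
    rw [mem_closedBall_zero_iff, le_div_iff₀ hk]
    by_contra hlt
    exact hu (by simp only [max_eq_right (by linarith : s - k * ‖u‖ ≤ 0)]; norm_num)
  have h1 : ∫ u : ℂ, max (s - k * ‖u‖) 0 ^ 2 ∂gaussianComplex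
      ≤ ∫ u : ℂ, max (s - k * ‖u‖) 0 ^ 2 ∂(ENNReal.ofReal Real.pi⁻¹ • volume) :=
    integral_mono_measure gaussianComplex_le (ae_of_all _ fun u => sq_nonneg _)
      (hint.smul_measure (by simp))
  have h2 : ∫ y in Set.Ioi (0 : ℝ), y ^ (Module.finrank ℝ ℂ - 1) • max (s - k * y) 0 ^ 2
      = s ^ 4 / (12 * k ^ 2) := by
    rw [Complex.finrank_real_complex]
    have hsk : 0 ≤ s / k := by positivity
    have e : ∫ y in Set.Ioi (0 : ℝ), y ^ (2 - 1) • max (s - k * y) 0 ^ 2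
        = ∫ y in Set.Ioc 0 (s / k), y * (s - k * y) ^ 2 := by
      rw [setIntegral_eq_of_subset_of_forall_sdiff_eq_zero measurableSet_Ioi
        (Set.Ioc_subset_Ioi_self : Set.Ioc 0 (s / k) ⊆ Set.Ioi 0)]
      · refine setIntegral_congr_fun measurableSet_Ioc fun y hy => ?_
        have : 0 ≤ s - k * y := by
          have := (le_div_iff₀ hk).1 hy.2; linarith
        simp only [max_eq_left this]
        simp
      · intro y hy
        have : s / k < y := by
          by_contra hle
          exact hy.2 ⟨hy.1, not_lt.1 hle⟩
        rw [div_lt_iff₀ hk] at this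
        simp only [max_eq_right (by linarith : s - k * y ≤ 0)]
        simp
    rw [e, ← intervalIntegral.integral_of_le hsk,
      intervalIntegral.integral_eq_sub_of_hasDerivAt
        (f := fun y => s ^ 2 * y ^ 2 / 2 - 2 * s * k * y ^ 3 / 3 + k ^ 2 * y ^ 4 / 4)]
    · field_simp; ring
    · intro y _
      have := ((((hasDerivAt_pow 2 y).const_mul (s ^ 2)).div_const 2).sub
        (((hasDerivAt_pow 3 y).const_mul (2 * s * k)).div_const 3)).add
        (((hasDerivAt_pow 4 y).const_mul (k ^ 2)).div_const 4)
      refine this.congr_deriv ?_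
      norm_num; ring
    · exact Continuous.intervalIntegrable (by fun_prop) _ _
  refine h1.trans_eq ?_
  rw [integral_smul_measure, integral_fun_norm_addHaar volume (fun y => max (s - k * y) 0 ^ 2), h2,
    Complex.finrank_real_complex, Measure.real, Complex.volume_ball,
    ENNReal.toReal_ofReal (by positivity)]
  simp
  field_simp
  try ring

/-! ### Population means of the three functions. -/

theorem measurable_phase : Measurable fun u : ℂ => (if u = 0 then 1 else u / ‖u‖ : ℂ) :=
  Measurable.ite (measurableSet_singleton 0) measurable_const (by fun_prop)

theorem measurable_phaseRe : Measurable fun p : ℂ × ℂ => phaseRe p.1 p.2 := by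
  unfold phaseRe
  have : Measurable fun p : ℂ × ℂ => (if p.1 = 0 then 1 else p.1 / ‖p.1‖ : ℂ) :=
    measurable_phase.comp measurable_fst
  have h2 : Measurable fun p : ℂ × ℂ =>
      starRingEnd ℂ (if p.1 = 0 then 1 else p.1 / ‖p.1‖ : ℂ) * p.2 :=
    (Complex.continuous_conj.measurable.comp this).mul measurable_snd
  exact (Complex.measurable_re.comp h2).abs

theorem measurable_excess (k : ℝ) : Measurable fun p : ℂ × ℂ => excess k p.1 p.2 := by
  unfold excess; fun_prop

theorem integrable_norm_sq_gaussianComplex :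
    Integrable (fun z : ℂ => ‖z‖ ^ 2) gaussianComplex := by
  simpa using integrable_norm_pow_gaussianComplex 1

theorem integral_comp_inner_pair {n : ℕ} {x h : EuclideanSpace ℂ (Fin n)} {d : ℝ} {c : ℂ}
    (hlaw : (complexGaussian n).map (fun a => ((inner ℂ a x : ℂ), (inner ℂ a h : ℂ)))
      = (gaussianComplex.prod gaussianComplex).map fun p => (p.1, c * p.1 + (d : ℂ) * p.2))
    {f : ℂ → ℂ → ℝ} (hf : Measurable fun p : ℂ × ℂ => f p.1 p.2) :
    ∫ a, f (inner ℂ a x) (inner ℂ a h) ∂complexGaussian n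
      = ∫ p, f p.1 (c * p.1 + (d : ℂ) * p.2) ∂(gaussianComplex.prod gaussianComplex) := by
  have h1 := integral_map (μ := complexGaussian n)
    (φ := fun a => ((inner ℂ a x : ℂ), (inner ℂ a h : ℂ))) (by fun_prop)
    (f := fun p : ℂ × ℂ => f p.1 p.2) hf.aestronglyMeasurable
  rw [← h1, hlaw, integral_map (by fun_prop) hf.aestronglyMeasurable]

theorem integrable_norm_sq_affine (c d : ℂ) :
    Integrable (fun p : ℂ × ℂ => ‖c * p.1 + d * p.2‖ ^ 2)
      (gaussianComplex.prod gaussianComplex) := by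
  have i := integrable_norm_sq_gaussianComplex
  have h : Integrable (fun p : ℂ × ℂ => 2 * ‖c‖ ^ 2 * ‖p.1‖ ^ 2 + 2 * ‖d‖ ^ 2 * ‖p.2‖ ^ 2)
      (gaussianComplex.prod gaussianComplex) :=
    ((i.comp_fst _).const_mul _).add ((i.comp_snd _).const_mul _)
  refine h.mono' (by fun_prop) (ae_of_all _ fun p => ?_)
  rw [Real.norm_of_nonneg (by positivity)]
  have h1 := norm_add_le (c * p.1) (d * p.2)
  rw [norm_mul, norm_mul] at h1
  have h2 := pow_le_pow_left₀ (norm_nonneg _) h1 2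
  nlinarith [sq_nonneg (‖c‖ * ‖p.1‖ - ‖d‖ * ‖p.2‖)]

/-- Write `a* h = c u + d g` with `g` independent of `u`. Since `c` is real, removing the phase of
`u` keeps all of `c u` and half of the energy of `d g`: the mean is `c² + d²/2` with `c² + d² = 1`.
-/
theorem integral_phaseRe_ge {n : ℕ} {x h : EuclideanSpace ℂ (Fin n)} (hx : ‖x‖ = 1)
    (hh : ‖h‖ = 1) (him : (inner ℂ x h : ℂ).im = 0) :
    1 / 2 ≤ ∫ a, phaseRe (inner ℂ a x) (inner ℂ a h) ^ 2 ∂complexGaussian n := by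
  obtain ⟨d, hd, hcd, hlaw⟩ := map_inner_prod h hx
  obtain ⟨c, hc⟩ : ∃ c : ℝ, (inner ℂ x h : ℂ) = (c : ℂ) :=
    ⟨_, (Complex.ext rfl (by rw [him]; rfl))⟩
  rw [hc] at hlaw hcd
  rw [hh, Complex.norm_real, Real.norm_eq_abs, sq_abs] at hcd
  rw [integral_comp_inner_pair hlaw (f := fun u v => phaseRe u v ^ 2) (measurable_phaseRe.pow_const 2)]
  have hmeas : Measurable fun p : ℂ × ℂ => phaseRe p.1 ((c : ℂ) * p.1 + (d : ℂ) * p.2) ^ 2 :=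
    (measurable_phaseRe.comp (by fun_prop :
      Measurable fun p : ℂ × ℂ => (p.1, (c : ℂ) * p.1 + (d : ℂ) * p.2))).pow_const 2
  rw [integral_prod _ ((integrable_norm_sq_affine c d).mono' hmeas.aestronglyMeasurable
    (ae_of_all _ fun p => by
      rw [Real.norm_of_nonneg (sq_nonneg _)]
      exact pow_le_pow_left₀ (abs_nonneg _) (phaseRe_le_norm _ _) 2))]
  have hin : ∀ u : ℂ, ∫ g, phaseRe u ((c : ℂ) * u + (d : ℂ) * g) ^ 2 ∂gaussianComplex
      = c ^ 2 * ‖u‖ ^ 2 + d ^ 2 / 2 := by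
    intro u
    set ω : ℂ := starRingEnd ℂ (if u = 0 then 1 else u / ‖u‖) with hω
    have hω1 : ‖ω‖ = 1 := by rw [hω, RCLike.norm_conj, norm_phase]
    have hωu : ω * u = ‖u‖ := by
      rw [hω]
      split_ifs with h0
      · simp [h0]
      · have : (‖u‖ : ℂ) ≠ 0 := by simpa using h0
        rw [map_div₀, Complex.conj_ofReal, div_mul_eq_mul_div, mul_comm, Complex.mul_conj,
          Complex.normSq_eq_norm_sq]
        push_cast
        field_simp
    have e : ∀ g : ℂ, phaseRe u ((c : ℂ) * u + (d : ℂ) * g) ^ 2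
        = c ^ 2 * ‖u‖ ^ 2 + 2 * c * ‖u‖ * d * (ω * g).re + d ^ 2 * (ω * g).re ^ 2 := by
      intro g
      have : ω * ((c : ℂ) * u + (d : ℂ) * g) = ((c * ‖u‖ : ℝ) : ℂ) + (d : ℂ) * (ω * g) := by
        push_cast
        rw [← hωu]; ring
      rw [phaseRe, ← hω, sq_abs, this, Complex.add_re, Complex.ofReal_re, Complex.re_ofReal_mul]
      ring
    simp_rw [e]
    have i2 : Integrable (fun g : ℂ => (ω * g).re ^ 2) gaussianComplex := by
      refine integrable_norm_sq_gaussianComplex.mono' (by fun_prop) (ae_of_all _ fun g => ?_)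
      rw [Real.norm_of_nonneg (sq_nonneg _), ← sq_abs]
      refine pow_le_pow_left₀ (abs_nonneg _) ((Complex.abs_re_le_norm _).trans ?_) 2
      rw [norm_mul, hω1, one_mul]
    have i1 : Integrable (fun g : ℂ => (ω * g).re) gaussianComplex := by
      refine ((integrable_const (1 : ℝ)).add i2).mono' (by fun_prop) (ae_of_all _ fun g => ?_)
      rw [Real.norm_eq_abs, Pi.add_apply]
      nlinarith [sq_nonneg (|(ω * g).re| - 1), sq_abs (ω * g).re, abs_nonneg (ω * g).re]
    have i01 : Integrable (fun g : ℂ => c ^ 2 * ‖u‖ ^ 2 + 2 * c * ‖u‖ * d * (ω * g).re)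
        gaussianComplex := (integrable_const _).add (i1.const_mul _)
    rw [integral_add i01 (i2.const_mul _), integral_add (integrable_const _) (i1.const_mul _),
      integral_const_mul (2 * c * ‖u‖ * d), integral_const_mul (d ^ 2),
      integral_re_mul_gaussianComplex,
      integral_re_mul_sq_gaussianComplex hω1]
    simp
    ring
  simp only [hin]
  rw [integral_add (integrable_norm_sq_gaussianComplex.const_mul _) (integrable_const _),
    integral_const_mul, integral_norm_sq_gaussianComplex]
  simp
  nlinarith [sq_nonneg c]

/-- The excess is at most the positive part of `d |g| - (k - |c|) |u|`. Integrating over `u` by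
`integral_excess_radial_le` and then using `E |g|⁴ = 2` gives `d⁴ / (3 (k - |c|)²)`. -/
theorem integral_excess_le {n : ℕ} {x h : EuclideanSpace ℂ (Fin n)} (hx : ‖x‖ = 1)
    (hh : ‖h‖ = 1) {ρ : ℝ} (hρ : 0 < ρ) (hρ' : ρ < 0.16334) :
    ∫ a, excess (2 / 5 / ρ) (inner ℂ a x) (inner ℂ a h) ^ 2 ∂complexGaussian n
      ≤ 2.35 * ρ ^ 2 := by
  obtain ⟨d, hd, hcd, hlaw⟩ := map_inner_prod h hx
  set c : ℂ := inner ℂ x h with hc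
  rw [hh, one_pow] at hcd
  have hc1 : ‖c‖ ≤ 1 := by nlinarith [sq_nonneg d, norm_nonneg c]
  set k := 2 / 5 / ρ with hk
  have hk2 : 2 < k := by rw [hk, lt_div_iff₀ hρ]; linarith
  have hkρ : k * ρ = 2 / 5 := by rw [hk]; field_simp
  have hk' : 0 < k - ‖c‖ := by linarith
  rw [integral_comp_inner_pair hlaw (f := fun u v => excess k u v ^ 2)
    ((measurable_excess k).pow_const 2)]
  have hpt : ∀ p : ℂ × ℂ, excess k p.1 (c * p.1 + (d : ℂ) * p.2) ^ 2
      ≤ max (d * ‖p.2‖ - (k - ‖c‖) * ‖p.1‖) 0 ^ 2 := by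
    intro p
    refine pow_le_pow_left₀ (le_max_right _ _) (max_le_max ?_ le_rfl) 2
    have := norm_add_le (c * p.1) ((d : ℂ) * p.2)
    rw [norm_mul, norm_mul, Complex.norm_real, Real.norm_of_nonneg hd] at this
    linarith
  have hint : Integrable (fun p : ℂ × ℂ => max (d * ‖p.2‖ - (k - ‖c‖) * ‖p.1‖) 0 ^ 2)
      (gaussianComplex.prod gaussianComplex) := by
    refine ((integrable_norm_sq_gaussianComplex.comp_snd _).const_mul (d ^ 2)).mono'
      (by fun_prop) (ae_of_all _ fun p => ?_)
    rw [Real.norm_of_nonneg (sq_nonneg _), ← mul_pow]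
    exact pow_le_pow_left₀ (le_max_right _ _) (max_le (by nlinarith [norm_nonneg p.1])
      (by positivity)) 2
  have h1 : ∫ p, excess k p.1 (c * p.1 + (d : ℂ) * p.2) ^ 2 ∂(gaussianComplex.prod gaussianComplex)
      ≤ ∫ p : ℂ × ℂ, max (d * ‖p.2‖ - (k - ‖c‖) * ‖p.1‖) 0 ^ 2
        ∂(gaussianComplex.prod gaussianComplex) :=
    integral_mono_of_nonneg (ae_of_all _ fun p => sq_nonneg _) hint (ae_of_all _ hpt)
  have i4 : Integrable (fun z : ℂ => ‖z‖ ^ 4) gaussianComplex :=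
    integrable_norm_pow_gaussianComplex 2
  have h2 : ∫ p : ℂ × ℂ, max (d * ‖p.2‖ - (k - ‖c‖) * ‖p.1‖) 0 ^ 2
        ∂(gaussianComplex.prod gaussianComplex) ≤ d ^ 4 / (3 * (k - ‖c‖) ^ 2) := by
    rw [integral_prod_symm _ hint]
    calc _ ≤ ∫ g : ℂ, d ^ 4 / (6 * (k - ‖c‖) ^ 2) * ‖g‖ ^ 4 ∂gaussianComplex := by
          refine integral_mono_of_nonneg
            (ae_of_all _ fun g => integral_nonneg fun u => sq_nonneg _) (i4.const_mul _)
            (ae_of_all _ fun g => ?_)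
          refine (integral_excess_radial_le (s := d * ‖g‖) (by positivity) hk').trans_eq ?_
          ring
      _ = d ^ 4 / (3 * (k - ‖c‖) ^ 2) := by
          rw [integral_const_mul, integral_norm_pow_four_gaussianComplex]
          field_simp
          ring
  refine h1.trans (h2.trans ?_)
  rw [div_le_iff₀ (by positivity)]
  -- Because `d² = 1 - |c|²` and `k ρ = 2/5`, this is a quadratic inequality in `|c|` of negative
  -- discriminant for `ρ < 0.16334`. The constant fits: `2.65² / 3 < 2.35`.
  have h3 : d ^ 2 ≤ 2.65 * ρ * (k - ‖c‖) := by
    have : 2.65 * ρ * (k - ‖c‖) = 2.65 * (2 / 5 - ‖c‖ * ρ) := by rw [← hkρ]; ring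
    rw [this]
    nlinarith [sq_nonneg (‖c‖ - 0.2165), norm_nonneg c]
  have h4 : (d ^ 2) ^ 2 ≤ (2.65 * ρ * (k - ‖c‖)) ^ 2 := pow_le_pow_left₀ (sq_nonneg _) h3 2
  have h5 : 0 ≤ ρ ^ 2 * (k - ‖c‖) ^ 2 := by positivity
  nlinarith

/-! ### Exponential deviation inequalities. -/

theorem exp_le_one_add_sq_mul_exp (x : ℝ) :
    Real.exp x ≤ 1 + x + x ^ 2 * Real.exp |x| := by
  rcases le_total |x| 1 with h | h
  · have h1 := (abs_le.1 (Real.abs_exp_sub_one_sub_id_le h)).2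
    have h2 : 1 ≤ Real.exp |x| := Real.one_le_exp (abs_nonneg x)
    nlinarith [sq_nonneg x]
  · have hx2 : 1 ≤ x ^ 2 := by rw [← sq_abs]; nlinarith
    rcases le_total 0 x with h0 | h0
    · rw [abs_of_nonneg h0]
      nlinarith [Real.exp_pos x]
    · have h1 : Real.exp x ≤ 1 := Real.exp_le_one_iff.2 h0
      have h2 : 1 ≤ Real.exp |x| := Real.one_le_exp (abs_nonneg x)
      rw [abs_of_nonpos h0] at h
      nlinarith [sq_nonneg (x + 1), Real.exp_pos |x|]

/-- Moment generating function of a centered variable with subexponential envelope `V`. -/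
theorem mgf_le_of_envelope {α : Type*} [MeasurableSpace α] {ν : Measure α} [IsProbabilityMeasure ν]
    {Y V : α → ℝ} {θ t : ℝ} (hY : Measurable Y) (hYV : ∀ a, |Y a| ≤ V a)
    (hV : Integrable (fun a => Real.exp (θ * V a)) ν) (hθ : 0 < θ) (ht : |t| ≤ θ / 2)
    (h0 : ∫ a, Y a ∂ν = 0) :
    Integrable (fun a => Real.exp (t * Y a)) ν ∧
      mgf Y ν t ≤ Real.exp (t ^ 2 * (8 / θ ^ 2 * ∫ a, Real.exp (θ * V a) ∂ν)) := by
  have hV0 : ∀ a, 0 ≤ V a := fun a => (abs_nonneg _).trans (hYV a)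
  have htY : ∀ a, |t * Y a| ≤ θ / 2 * V a := fun a => by
    rw [abs_mul]; exact mul_le_mul ht (hYV a) (abs_nonneg _) (by positivity)
  have hint : Integrable (fun a => Real.exp (t * Y a)) ν := by
    refine hV.mono' (by fun_prop) (ae_of_all _ fun a => ?_)
    rw [Real.norm_of_nonneg (Real.exp_pos _).le]
    refine Real.exp_le_exp.2 ((le_abs_self _).trans ((htY a).trans ?_))
    nlinarith [hV0 a]
  have hYint : Integrable Y ν := by
    refine (hV.const_mul (1 / θ)).mono' hY.aestronglyMeasurable (ae_of_all _ fun a => ?_)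
    rw [Real.norm_eq_abs, one_div_mul_eq_div, le_div_iff₀ hθ]
    nlinarith [Real.add_one_le_exp (θ * V a), hYV a]
  refine ⟨hint, ?_⟩
  have hpt : ∀ a, Real.exp (t * Y a)
      ≤ 1 + t * Y a + t ^ 2 * (8 / θ ^ 2) * Real.exp (θ * V a) := by
    intro a
    refine (exp_le_one_add_sq_mul_exp _).trans ?_
    have h1 : Real.exp |t * Y a| ≤ Real.exp (θ / 2 * V a) := Real.exp_le_exp.2 (htY a)
    -- Half of the exponential envelope absorbs `Y²`; the other half is kept for `exp |t Y|`.
    have h2 : Y a ^ 2 ≤ 8 / θ ^ 2 * Real.exp (θ / 2 * V a) := by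
      have h3 := Real.pow_div_factorial_le_exp (θ / 2 * V a) (mul_nonneg (by positivity) (hV0 a)) 2
      have h4 : Y a ^ 2 ≤ V a ^ 2 := by
        rw [← sq_abs]; exact pow_le_pow_left₀ (abs_nonneg _) (hYV a) 2
      rw [div_mul_eq_mul_div, le_div_iff₀ (by positivity)]
      simp only [Nat.factorial] at h3
      push_cast at h3
      nlinarith [mul_le_mul_of_nonneg_right h4 (sq_nonneg θ)]
    have h5 : Real.exp (θ * V a) = Real.exp (θ / 2 * V a) * Real.exp (θ / 2 * V a) := by
      rw [← Real.exp_add]; congr 1; ring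
    rw [h5, mul_pow]
    have : t ^ 2 * Y a ^ 2 * Real.exp |t * Y a|
        ≤ t ^ 2 * (8 / θ ^ 2 * Real.exp (θ / 2 * V a)) * Real.exp (θ / 2 * V a) := by gcongr
    linarith
  have i1 : Integrable (fun a => 1 + t * Y a) ν := (integrable_const _).add (hYint.const_mul t)
  calc mgf Y ν t ≤ ∫ a, (1 + t * Y a + t ^ 2 * (8 / θ ^ 2) * Real.exp (θ * V a)) ∂ν :=
        integral_mono hint (i1.add (hV.const_mul _)) hpt
    _ = t ^ 2 * (8 / θ ^ 2 * ∫ a, Real.exp (θ * V a) ∂ν) + 1 := by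
        rw [integral_add i1 (hV.const_mul _), integral_add (integrable_const _)
          (hYint.const_mul t), integral_const_mul, integral_const_mul, h0]
        simp; ring
    _ ≤ _ := Real.add_one_le_exp _

/-- Chernoff bound for the sum of a function of i.i.d. variables. -/
theorem measure_sum_ge_le_of_mgf {α Ω : Type*} [MeasurableSpace α] [MeasurableSpace Ω]
    {ν : Measure α} {P : Measure Ω} [IsProbabilityMeasure P] {m : ℕ} {X : Fin m → Ω → α}
    (hX : ∀ j, HasLaw (X j) ν P) (hind : iIndepFun X P) {Y : α → ℝ} (hY : Measurable Y)
    {t s : ℝ} (ht : 0 ≤ t) (hint : Integrable (fun a => Real.exp (t * Y a)) ν)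
    (hmgf : mgf Y ν t ≤ Real.exp s) (ε : ℝ) :
    P.real {ω | (m : ℝ) * ε ≤ ∑ j, Y (X j ω)} ≤ Real.exp (-(m * (t * ε - s))) := by
  have hind' : iIndepFun (fun j ω => Y (X j ω)) P := hind.comp (fun _ => Y) fun _ => hY
  have hm : ∀ j, AEMeasurable (fun ω => Y (X j ω)) P := fun j =>
    hY.comp_aemeasurable (hX j).aemeasurable
  have hi : ∀ j, Integrable (fun ω => Real.exp (t * Y (X j ω))) P := fun j => by
    have : Integrable (fun a => Real.exp (t * Y a)) (P.map (X j)) := by rwa [(hX j).map_eq]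
    exact this.comp_aemeasurable (hX j).aemeasurable
  have hmg : ∀ j, mgf (fun ω => Y (X j ω)) P t = mgf Y ν t := fun j => by
    rw [mgf, mgf, ← (hX j).map_eq, integral_map (hX j).aemeasurable]
    rw [(hX j).map_eq]; exact hint.aestronglyMeasurable
  have h1 : Integrable (fun ω => Real.exp (t * (∑ j, fun ω => Y (X j ω)) ω)) P := by
    -- A non-integrable exponential would have `mgf` equal to the default value `0`, against the
    -- product formula, whose factors are positive.
    by_contra hni
    have h0 := hind'.mgf_sum₀ (t := t) hm Finset.univ
    rw [mgf_undef hni] at h0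
    exact (Finset.prod_pos fun j _ => mgf_pos (hi j)).ne h0
  have h2 := measure_ge_le_exp_mul_mgf (μ := P) (X := ∑ j, fun ω => Y (X j ω)) (m * ε) ht h1
  rw [hind'.mgf_sum₀ hm] at h2
  simp only [hmg, Finset.prod_const, Finset.card_univ, Fintype.card_fin, Finset.sum_apply] at h2
  refine h2.trans ?_
  have h3 : mgf Y ν t ^ m ≤ Real.exp s ^ m := pow_le_pow_left₀ mgf_nonneg hmgf m
  calc _ ≤ Real.exp (-t * (m * ε)) * Real.exp s ^ m := by gcongr
    _ = _ := by rw [← Real.exp_nat_mul, ← Real.exp_add]; congr 1; ring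

/-! ### Gauges and their empirical and population means. -/

/-- The functions of `(a* x, a* h)` whose empirical second moments are controlled uniformly. -/
structure IsGauge (φ : ℂ → ℂ → ℝ) : Prop where
  measurable : Measurable fun p : ℂ × ℂ => φ p.1 p.2
  nonneg : ∀ u v, 0 ≤ φ u v
  le_norm : ∀ u v, φ u v ≤ ‖v‖
  lipschitz : ∀ u v w, |φ u v - φ u w| ≤ ‖v - w‖

theorem isGauge_norm : IsGauge fun _ v => ‖v‖ :=
  ⟨by fun_prop, fun _ _ => norm_nonneg _, fun _ _ => le_rfl, fun _ => abs_norm_sub_norm_le⟩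

theorem isGauge_phaseRe : IsGauge phaseRe :=
  ⟨measurable_phaseRe, fun _ _ => abs_nonneg _, phaseRe_le_norm, abs_phaseRe_sub_le⟩

theorem isGauge_excess {k : ℝ} (hk : 0 ≤ k) : IsGauge (excess k) :=
  ⟨measurable_excess k, fun _ _ => le_max_right _ _, excess_le_norm hk, abs_excess_sub_le k⟩

/-- Empirical second moment. -/
def empMean {n m : ℕ} (φ : ℂ → ℂ → ℝ) (a : Fin m → EuclideanSpace ℂ (Fin n))
    (x h : EuclideanSpace ℂ (Fin n)) : ℝ :=
  (1 / (m : ℝ)) * ∑ j, φ (inner ℂ (a j) x) (inner ℂ (a j) h) ^ 2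

/-- Second moment under the Gaussian law. -/
def popMean {n : ℕ} (φ : ℂ → ℂ → ℝ) (x h : EuclideanSpace ℂ (Fin n)) : ℝ :=
  ∫ a, φ (inner ℂ a x) (inner ℂ a h) ^ 2 ∂complexGaussian n

theorem integral_comp_inner_unit {n : ℕ} {h : EuclideanSpace ℂ (Fin n)} (hh : ‖h‖ = 1)
    {f : ℂ → ℝ} (hf : Measurable f) :
    ∫ a, f (inner ℂ a h) ∂complexGaussian n = ∫ z, f z ∂gaussianComplex := by
  rw [← map_inner_unit hh, integral_map (by fun_prop) hf.aestronglyMeasurable]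

theorem integrable_comp_inner_unit {n : ℕ} {h : EuclideanSpace ℂ (Fin n)} (hh : ‖h‖ = 1)
    {f : ℂ → ℝ} (hf : Integrable f gaussianComplex) :
    Integrable (fun a => f (inner ℂ a h)) (complexGaussian n) := by
  rw [← map_inner_unit hh] at hf
  exact hf.comp_measurable (by fun_prop)

theorem integral_norm_inner_sq {n : ℕ} (h : EuclideanSpace ℂ (Fin n)) :
    Integrable (fun a => ‖(inner ℂ a h : ℂ)‖ ^ 2) (complexGaussian n) ∧
      ∫ a, ‖(inner ℂ a h : ℂ)‖ ^ 2 ∂complexGaussian n = ‖h‖ ^ 2 := by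
  rcases eq_or_ne h 0 with rfl | h0
  · simp
  have hn : (‖h‖ : ℂ) ≠ 0 := by simpa using h0
  obtain ⟨g, hg, hgh⟩ : ∃ g : EuclideanSpace ℂ (Fin n), ‖g‖ = 1 ∧ h = (‖h‖ : ℂ) • g := by
    refine ⟨(‖h‖ : ℂ)⁻¹ • h, ?_, ?_⟩
    · rw [norm_smul]; simp [h0]
    · rw [smul_smul, mul_inv_cancel₀ hn, one_smul]
  have e : ∀ a : EuclideanSpace ℂ (Fin n),
      ‖(inner ℂ a h : ℂ)‖ ^ 2 = ‖h‖ ^ 2 * ‖(inner ℂ a g : ℂ)‖ ^ 2 := by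
    intro a
    conv_lhs => rw [hgh]
    rw [inner_smul_right, norm_mul, mul_pow]; simp
  simp_rw [e]
  refine ⟨(integrable_comp_inner_unit hg integrable_norm_sq_gaussianComplex).const_mul _, ?_⟩
  rw [integral_const_mul, integral_comp_inner_unit hg (f := fun z => ‖z‖ ^ 2) (by fun_prop),
    integral_norm_sq_gaussianComplex, mul_one]

theorem IsGauge.integrable {φ : ℂ → ℂ → ℝ} (hφ : IsGauge φ) {n : ℕ}
    (x h : EuclideanSpace ℂ (Fin n)) :
    Integrable (fun a => φ (inner ℂ a x) (inner ℂ a h) ^ 2) (complexGaussian n) := by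
  refine (integral_norm_inner_sq h).1.mono' ?_ (ae_of_all _ fun a => ?_)
  · exact ((hφ.measurable.comp (by fun_prop : Measurable fun a : EuclideanSpace ℂ (Fin n) =>
      ((inner ℂ a x : ℂ), (inner ℂ a h : ℂ)))).pow_const 2).aestronglyMeasurable
  · rw [Real.norm_of_nonneg (sq_nonneg _)]
    exact pow_le_pow_left₀ (hφ.nonneg _ _) (hφ.le_norm _ _) 2

/-- The envelope `|a* h|² + 1` of the centered variable has the same law for every unit `h`, so `c`
is uniform in the gauge, in `n`, `m` and in both vectors. -/
theorem IsGauge.concentration_point {ε : ℝ} (hε : 0 < ε) : ∃ c : ℝ, 0 < c ∧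
    ∀ (φ : ℂ → ℂ → ℝ), IsGauge φ → ∀ (n m : ℕ) (x h : EuclideanSpace ℂ (Fin n)), ‖h‖ = 1 →
    ∀ (Ω : Type*) [MeasurableSpace Ω] (P : Measure Ω) [IsProbabilityMeasure P]
      (a : Fin m → Ω → EuclideanSpace ℂ (Fin n)),
      (∀ j, HasLaw (a j) (complexGaussian n) P) → iIndepFun a P →
      P.real {ω | ε ≤ |empMean φ (fun j => a j ω) x h - popMean φ x h|}
        ≤ 2 * Real.exp (-(c * m)) := by
  obtain ⟨θ, hθ, hint⟩ := exists_integrable_exp_gaussianComplex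
  set M := ∫ z, Real.exp (θ * (‖z‖ ^ 2 + 1)) ∂gaussianComplex with hM
  have hM0 : 0 ≤ M := integral_nonneg fun z => (Real.exp_pos _).le
  set B := 8 / θ ^ 2 * M with hB
  have hB0 : 0 ≤ B := by positivity
  set t := min (θ / 2) (ε / (2 * (B + 1))) with ht
  have ht0 : 0 < t := lt_min (by positivity) (by positivity)
  have htθ : t ≤ θ / 2 := min_le_left _ _
  have htB : t * B ≤ ε / 2 := by
    have h1 : t ≤ ε / (2 * (B + 1)) := min_le_right _ _
    rw [le_div_iff₀ (by positivity)] at h1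
    nlinarith
  refine ⟨t * ε / 2, by positivity, fun φ hφ n m x h hh Ω _ P _ a ha hind => ?_⟩
  rcases Nat.eq_zero_or_pos m with rfl | hm
  · have : P.real {ω | ε ≤ |empMean φ (fun j => a j ω) x h - popMean φ x h|} ≤ 1 :=
      measureReal_le_one
    simp only [Nat.cast_zero, mul_zero, neg_zero, Real.exp_zero, mul_one]
    linarith
  set Y : EuclideanSpace ℂ (Fin n) → ℝ := fun a => φ (inner ℂ a x) (inner ℂ a h) ^ 2 - popMean φ x h
    with hY
  have hYm : Measurable Y := ((hφ.measurable.comp (by fun_prop : Measurable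
    fun a : EuclideanSpace ℂ (Fin n) => ((inner ℂ a x : ℂ), (inner ℂ a h : ℂ)))).pow_const 2).sub_const _
  have hpm0 : 0 ≤ popMean φ x h := integral_nonneg fun a => sq_nonneg _
  have hle : ∀ a : EuclideanSpace ℂ (Fin n),
      φ (inner ℂ a x) (inner ℂ a h) ^ 2 ≤ ‖(inner ℂ a h : ℂ)‖ ^ 2 := fun a =>
    pow_le_pow_left₀ (hφ.nonneg _ _) (hφ.le_norm _ _) 2
  have hpm1 : popMean φ x h ≤ 1 := by
    have h1 := integral_mono (hφ.integrable x h) (integral_norm_inner_sq h).1 hle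
    rwa [(integral_norm_inner_sq h).2, hh, one_pow] at h1
  have hYV : ∀ a, |Y a| ≤ ‖(inner ℂ a h : ℂ)‖ ^ 2 + 1 := fun a => by
    rw [hY, abs_le]
    constructor <;> nlinarith [hle a, sq_nonneg (φ (inner ℂ a x) (inner ℂ a h)),
      sq_nonneg ‖(inner ℂ a h : ℂ)‖]
  have hY0 : ∫ a, Y a ∂complexGaussian n = 0 := by
    rw [hY, integral_sub (hφ.integrable x h) (integrable_const _)]
    simp [popMean]
  have hVint : Integrable (fun a : EuclideanSpace ℂ (Fin n) =>
      Real.exp (θ * (‖(inner ℂ a h : ℂ)‖ ^ 2 + 1))) (complexGaussian n) := by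
    refine integrable_comp_inner_unit hh (f := fun z => Real.exp (θ * (‖z‖ ^ 2 + 1))) ?_
    refine (hint.mul_const (Real.exp θ)).congr (ae_of_all _ fun z => ?_)
    simp only
    rw [← Real.exp_add]; congr 1; ring
  have hVM : ∫ a, Real.exp (θ * (‖(inner ℂ a h : ℂ)‖ ^ 2 + 1)) ∂complexGaussian n = M :=
    integral_comp_inner_unit hh (f := fun z => Real.exp (θ * (‖z‖ ^ 2 + 1))) (by fun_prop)
  obtain ⟨i1, m1⟩ := mgf_le_of_envelope hYm hYV hVint hθ (by rwa [abs_of_pos ht0]) hY0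
  obtain ⟨i2, m2⟩ := mgf_le_of_envelope (Y := fun a => -Y a) hYm.neg (by simpa using hYV) hVint hθ
    (by rwa [abs_of_pos ht0]) (by rw [integral_neg, hY0, neg_zero])
  rw [hVM, ← hB] at m1 m2
  have p1 := measure_sum_ge_le_of_mgf ha hind hYm ht0.le i1 m1 ε
  have p2 := measure_sum_ge_le_of_mgf ha hind hYm.neg ht0.le i2 m2 ε
  have hexp : Real.exp (-(m * (t * ε - t ^ 2 * B))) ≤ Real.exp (-(t * ε / 2 * m)) := by
    refine Real.exp_le_exp.2 ?_
    have h1 : t * (t * B) ≤ t * (ε / 2) := by gcongr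
    have h2 : (m : ℝ) * (t * (t * B)) ≤ m * (t * (ε / 2)) := by gcongr
    nlinarith
  have hsub : {ω | ε ≤ |empMean φ (fun j => a j ω) x h - popMean φ x h|}
      ⊆ {ω | (m : ℝ) * ε ≤ ∑ j, Y (a j ω)} ∪ {ω | (m : ℝ) * ε ≤ ∑ j, -Y (a j ω)} := by
    intro ω hω
    have hm' : (0 : ℝ) < m := by exact_mod_cast hm
    have e : empMean φ (fun j => a j ω) x h - popMean φ x h = (∑ j, Y (a j ω)) / m := by
      rw [empMean, hY]
      simp only [Finset.sum_sub_distrib, Finset.sum_const, Finset.card_univ, Fintype.card_fin,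
        nsmul_eq_mul]
      field_simp
    simp only [Set.mem_ofPred_eq, e, Set.mem_union, Finset.sum_neg_distrib] at hω ⊢
    rcases le_abs.1 hω with h1 | h1
    · left
      rw [le_div_iff₀ hm'] at h1; linarith
    · right
      rw [← neg_div, le_div_iff₀ hm'] at h1; linarith
  calc _ ≤ _ := measureReal_mono hsub
    _ ≤ _ := measureReal_union_le _ _
    _ ≤ Real.exp (-(m * (t * ε - t ^ 2 * B))) + Real.exp (-(m * (t * ε - t ^ 2 * B))) :=
        add_le_add p1 p2
    _ ≤ _ := by linarith

/-! ### Nets of subsets of the unit ball. -/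

-- Balls of radius `η / 2` about the points are disjoint and lie in the ball of radius `1 + η / 2`;
-- compare volumes.
open Module in
open scoped Function in
theorem card_le_of_separated_unit_ball {E : Type*} [NormedAddCommGroup E] [NormedSpace ℝ E]
    [FiniteDimensional ℝ E] {η : ℝ} (hη : 0 < η) (s : Finset E) (hs : ∀ c ∈ s, ‖c‖ ≤ 1)
    (h : ∀ c ∈ s, ∀ d ∈ s, c ≠ d → η ≤ ‖c - d‖) :
    (s.card : ℝ) ≤ (1 + 2 / η) ^ finrank ℝ E := by
  borelize E
  let μ : Measure E := Measure.addHaar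
  let δ : ℝ := η / 2
  let ρ : ℝ := 1 + η / 2
  have ρpos : 0 < ρ := by positivity
  have δpos : 0 < δ := by positivity
  set A := ⋃ c ∈ s, Metric.ball (c : E) δ with hA
  have D : Set.Pairwise (s : Set E) (Disjoint on fun c => Metric.ball (c : E) δ) := by
    rintro c hc d hd hcd
    apply Metric.ball_disjoint_ball
    rw [dist_eq_norm]
    linarith [h c hc d hd hcd, (by ring : δ + δ = η)]
  have A_subset : A ⊆ Metric.ball (0 : E) ρ := by
    refine Set.iUnion₂_subset fun x hx => ?_
    apply Metric.ball_subset_ball'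
    rw [dist_zero_right]
    linarith [hs x hx]
  have I : (s.card : ℝ≥0∞) * ENNReal.ofReal (δ ^ finrank ℝ E) * μ (Metric.ball 0 1) ≤
      ENNReal.ofReal (ρ ^ finrank ℝ E) * μ (Metric.ball 0 1) :=
    calc
      (s.card : ℝ≥0∞) * ENNReal.ofReal (δ ^ finrank ℝ E) * μ (Metric.ball 0 1) = μ A := by
        rw [hA, measure_biUnion_finset D fun c _ => measurableSet_ball]
        simp only [μ.addHaar_ball_of_pos _ δpos]
        simp only [Finset.sum_const, nsmul_eq_mul, mul_assoc]
      _ ≤ μ (Metric.ball (0 : E) ρ) := measure_mono A_subset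
      _ = ENNReal.ofReal (ρ ^ finrank ℝ E) * μ (Metric.ball 0 1) := by
        simp only [μ.addHaar_ball_of_pos _ ρpos]
  have J : (s.card : ℝ≥0∞) * ENNReal.ofReal (δ ^ finrank ℝ E) ≤ ENNReal.ofReal (ρ ^ finrank ℝ E) :=
    (ENNReal.mul_le_mul_iff_left (Metric.measure_ball_pos _ _ zero_lt_one).ne'
      measure_ball_lt_top.ne).1 I
  have K := ENNReal.toReal_le_of_le_ofReal (pow_nonneg ρpos.le _) J
  rw [ENNReal.toReal_mul, ENNReal.toReal_natCast, ENNReal.toReal_ofReal (by positivity),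
    ← le_div_iff₀ (by positivity), ← div_pow] at K
  refine K.trans_eq ?_
  congr 1
  simp only [ρ, δ]
  field_simp
  ring

/-- If no net existed, every separated set could be enlarged without end, against the packing bound.
The exponent `2 n` is the real dimension. -/
theorem exists_net {n : ℕ} {η : ℝ} (hη : 0 < η) (S : Set (EuclideanSpace ℂ (Fin n)))
    (hS : ∀ h ∈ S, ‖h‖ ≤ 1) : ∃ N : Finset (EuclideanSpace ℂ (Fin n)), (∀ h ∈ N, h ∈ S) ∧
      (N.card : ℝ) ≤ (1 + 2 / η) ^ (2 * n) ∧ ∀ h ∈ S, ∃ g ∈ N, ‖h - g‖ ≤ η := by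
  classical
  have hcard : ∀ N : Finset (EuclideanSpace ℂ (Fin n)), (∀ h ∈ N, h ∈ S) →
      (∀ c ∈ N, ∀ d ∈ N, c ≠ d → η ≤ ‖c - d‖) → (N.card : ℝ) ≤ (1 + 2 / η) ^ (2 * n) := by
    intro N hN hsep
    have h1 := card_le_of_separated_unit_ball hη N (fun c hc => hS c (hN c hc)) hsep
    rwa [finrank_real_of_complex, finrank_euclideanSpace, Fintype.card_fin] at h1
  by_contra hno
  push Not at hno
  have key : ∀ k : ℕ, ∃ N : Finset (EuclideanSpace ℂ (Fin n)), (∀ h ∈ N, h ∈ S) ∧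
      (∀ c ∈ N, ∀ d ∈ N, c ≠ d → η ≤ ‖c - d‖) ∧ N.card = k := by
    intro k
    induction k with
    | zero => exact ⟨∅, by simp⟩
    | succ k ih =>
      obtain ⟨N, hN, hsep, hk⟩ := ih
      obtain ⟨h, hhS, hfar⟩ := hno N hN (hcard N hN hsep)
      have hnot : h ∉ N := fun hmem => by
        have := hfar h hmem
        rw [sub_self, norm_zero] at this
        linarith
      refine ⟨insert h N, ?_, ?_, by rw [Finset.card_insert_of_notMem hnot, hk]⟩
      · intro g hg
        rcases Finset.mem_insert.1 hg with rfl | hg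
        exacts [hhS, hN g hg]
      · intro c hc d hd hcd
        rcases Finset.mem_insert.1 hc with rfl | hc <;> rcases Finset.mem_insert.1 hd with rfl | hd
        · exact absurd rfl hcd
        · exact (hfar d hd).le
        · rw [norm_sub_rev]; exact (hfar c ‹_›).le
        · exact hsep c hc d hd hcd
  obtain ⟨N, hN, hsep, hk⟩ := key (⌊(1 + 2 / η) ^ (2 * n)⌋₊ + 1)
  have h1 := hcard N hN hsep
  rw [hk] at h1
  have h2 := Nat.lt_floor_add_one ((1 + 2 / η) ^ (2 * n))
  push_cast at h1
  linarith

/-! ### From a net to the whole sphere. -/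

theorem empMean_norm_smul {n m : ℕ} (a : Fin m → EuclideanSpace ℂ (Fin n))
    (x h : EuclideanSpace ℂ (Fin n)) (c : ℂ) :
    empMean (fun _ v => ‖v‖) a x (c • h) = ‖c‖ ^ 2 * empMean (fun _ v => ‖v‖) a x h := by
  simp only [empMean, inner_smul_right, norm_mul, mul_pow, ← Finset.mul_sum]
  ring

/-- If the empirical second moment is bounded by `C` on the unit sphere, then everywhere. -/
theorem empMean_norm_le_of_unit {n m : ℕ} {a : Fin m → EuclideanSpace ℂ (Fin n)}
    {x : EuclideanSpace ℂ (Fin n)} {C : ℝ}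
    (hC : ∀ h, ‖h‖ = 1 → empMean (fun _ v => ‖v‖) a x h ≤ C) (h : EuclideanSpace ℂ (Fin n)) :
    empMean (fun _ v => ‖v‖) a x h ≤ C * ‖h‖ ^ 2 := by
  rcases eq_or_ne h 0 with rfl | h0
  · simp [empMean]
  · have hn : (‖h‖ : ℂ) ≠ 0 := by simpa using h0
    have e : h = (‖h‖ : ℂ) • ((‖h‖ : ℂ)⁻¹ • h) := by
      rw [smul_smul, mul_inv_cancel₀ hn, one_smul]
    have h1 := hC ((‖h‖ : ℂ)⁻¹ • h) (by rw [norm_smul]; simp [h0])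
    rw [e, empMean_norm_smul, ← e]
    simp only [Complex.norm_real, norm_norm]
    nlinarith [sq_nonneg ‖h‖]

/-- Weighted AM-GM on `|v - w| (|v| + |w|)`. After averaging, only second moments of `|a* ·|`
remain; for vectors at distance `η` both terms are of order `η`. -/
theorem IsGauge.abs_sq_sub_le {φ : ℂ → ℂ → ℝ} (hφ : IsGauge φ) {η : ℝ} (hη : 0 < η) (u v w : ℂ) :
    |φ u v ^ 2 - φ u w ^ 2| ≤ 1 / (2 * η) * ‖v - w‖ ^ 2 + η * (‖v‖ ^ 2 + ‖w‖ ^ 2) := by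
  have h1 : |φ u v ^ 2 - φ u w ^ 2| ≤ ‖v - w‖ * (‖v‖ + ‖w‖) := by
    rw [sq_sub_sq, mul_comm, abs_mul, abs_of_nonneg (add_nonneg (hφ.nonneg u v) (hφ.nonneg u w))]
    exact mul_le_mul (hφ.lipschitz u v w) (add_le_add (hφ.le_norm u v) (hφ.le_norm u w))
      (add_nonneg (hφ.nonneg u v) (hφ.nonneg u w)) (norm_nonneg _)
  refine h1.trans ?_
  have h2 : 0 ≤ 1 / (2 * η) * (‖v - w‖ - η * (‖v‖ + ‖w‖)) ^ 2 := by positivity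
  have h3 : 1 / (2 * η) * (‖v - w‖ - η * (‖v‖ + ‖w‖)) ^ 2
      = 1 / (2 * η) * ‖v - w‖ ^ 2 - ‖v - w‖ * (‖v‖ + ‖w‖) + η / 2 * (‖v‖ + ‖w‖) ^ 2 := by
    field_simp; ring
  nlinarith [mul_nonneg hη.le (sq_nonneg (‖v‖ - ‖w‖))]

theorem IsGauge.abs_empMean_sub_le {φ : ℂ → ℂ → ℝ} (hφ : IsGauge φ) {η : ℝ} (hη : 0 < η)
    {n m : ℕ} (a : Fin m → EuclideanSpace ℂ (Fin n)) (x h g : EuclideanSpace ℂ (Fin n)) :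
    |empMean φ a x h - empMean φ a x g| ≤ 1 / (2 * η) * empMean (fun _ v => ‖v‖) a x (h - g)
      + η * (empMean (fun _ v => ‖v‖) a x h + empMean (fun _ v => ‖v‖) a x g) := by
  simp only [empMean]
  rw [← mul_sub, ← Finset.sum_sub_distrib, abs_mul, abs_of_nonneg (by positivity : 0 ≤ 1 / (m : ℝ))]
  calc _ ≤ 1 / (m : ℝ) * ∑ j, (1 / (2 * η) * ‖(inner ℂ (a j) (h - g) : ℂ)‖ ^ 2
        + η * (‖(inner ℂ (a j) h : ℂ)‖ ^ 2 + ‖(inner ℂ (a j) g : ℂ)‖ ^ 2)) := by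
        refine mul_le_mul_of_nonneg_left ((Finset.abs_sum_le_sum_abs _ _).trans
          (Finset.sum_le_sum fun j _ => ?_)) (by positivity)
        rw [inner_sub_right]
        exact hφ.abs_sq_sub_le hη _ _ _
    _ = _ := by
        rw [Finset.sum_add_distrib, ← Finset.mul_sum, ← Finset.mul_sum, Finset.sum_add_distrib]
        ring

theorem IsGauge.abs_popMean_sub_le {φ : ℂ → ℂ → ℝ} (hφ : IsGauge φ) {η : ℝ} (hη : 0 < η)
    {n : ℕ} (x h g : EuclideanSpace ℂ (Fin n)) :
    |popMean φ x h - popMean φ x g|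
      ≤ 1 / (2 * η) * ‖h - g‖ ^ 2 + η * (‖h‖ ^ 2 + ‖g‖ ^ 2) := by
  obtain ⟨i1, e1⟩ := integral_norm_inner_sq (h - g)
  obtain ⟨i2, e2⟩ := integral_norm_inner_sq h
  obtain ⟨i3, e3⟩ := integral_norm_inner_sq g
  have i23 : Integrable (fun a : EuclideanSpace ℂ (Fin n) =>
    ‖(inner ℂ a h : ℂ)‖ ^ 2 + ‖(inner ℂ a g : ℂ)‖ ^ 2) (complexGaussian n) := i2.add i3
  rw [popMean, popMean, ← integral_sub (hφ.integrable x h) (hφ.integrable x g)]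
  refine (abs_integral_le_integral_abs).trans ?_
  rw [← e1, ← e2, ← e3, ← integral_add i2 i3, ← integral_const_mul, ← integral_const_mul,
    ← integral_add (i1.const_mul _) (i23.const_mul _)]
  refine integral_mono ((hφ.integrable x h).sub (hφ.integrable x g)).abs
    ((i1.const_mul _).add (i23.const_mul _)) fun a => ?_
  simp only
  rw [inner_sub_right]
  exact hφ.abs_sq_sub_le hη _ _ _

/-- Second moments bounded by `2` on a `1/2`-net of the sphere are bounded by `8` on the sphere. -/
theorem empMean_norm_le_of_net {n m : ℕ} {a : Fin m → EuclideanSpace ℂ (Fin n)}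
    {x : EuclideanSpace ℂ (Fin n)} {η : ℝ} (hη : 0 ≤ η) (hη' : η ≤ 1 / 2)
    {N : Finset (EuclideanSpace ℂ (Fin n))}
    (hnet : ∀ h : EuclideanSpace ℂ (Fin n), ‖h‖ = 1 → ∃ g ∈ N, ‖h - g‖ ≤ η)
    (hN : ∀ g ∈ N, empMean (fun _ v => ‖v‖) a x g ≤ 2) (h : EuclideanSpace ℂ (Fin n)) :
    empMean (fun _ v => ‖v‖) a x h ≤ 8 * ‖h‖ ^ 2 := by
  refine empMean_norm_le_of_unit (fun h hh => ?_) h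
  have hcont : Continuous fun h => empMean (fun _ v => ‖v‖) a x h := by
    unfold empMean; fun_prop
  obtain ⟨k, hk, hmax⟩ := (isCompact_sphere (0 : EuclideanSpace ℂ (Fin n)) 1).exists_isMaxOn
    ⟨h, by simpa using hh⟩ hcont.continuousOn
  have hk1 : ‖k‖ = 1 := by simpa using hk
  have hle : ∀ g, ‖g‖ = 1 → empMean (fun _ v => ‖v‖) a x g ≤ empMean (fun _ v => ‖v‖) a x k :=
    fun g hg => hmax (by simpa using hg : g ∈ Metric.sphere 0 1)
  obtain ⟨g, hg, hkg⟩ := hnet k hk1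
  -- Self-bounding at the maximizer `k`: its value `E` satisfies `E ≤ 2 · 2 + 2 · E / 4`, so `E ≤
  -- 8`.
  have h1 : empMean (fun _ v => ‖v‖) a x k
      ≤ 2 * empMean (fun _ v => ‖v‖) a x g + 2 * empMean (fun _ v => ‖v‖) a x (k - g) := by
    simp only [empMean]
    rw [mul_left_comm, mul_left_comm 2, ← mul_add, Finset.mul_sum (a := (2 : ℝ)),
      Finset.mul_sum (a := (2 : ℝ)), ← Finset.sum_add_distrib]
    refine mul_le_mul_of_nonneg_left (Finset.sum_le_sum fun j _ => ?_) (by positivity)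
    have h2 : (inner ℂ (a j) k : ℂ) = inner ℂ (a j) g + inner ℂ (a j) (k - g) := by
      rw [← inner_add_right]; congr 1; abel
    have h3 := norm_add_le (inner ℂ (a j) g : ℂ) (inner ℂ (a j) (k - g))
    rw [← h2] at h3
    have h4 := pow_le_pow_left₀ (norm_nonneg _) h3 2
    nlinarith [sq_nonneg (‖(inner ℂ (a j) g : ℂ)‖ - ‖(inner ℂ (a j) (k - g) : ℂ)‖)]
  have h2 := empMean_norm_le_of_unit hle (k - g)
  have h3 : ‖k - g‖ ^ 2 ≤ 1 / 4 := by nlinarith [norm_nonneg (k - g)]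
  have h4 : 0 ≤ empMean (fun _ v => ‖v‖) a x k := by unfold empMean; positivity
  have h5 := hN g hg
  have h6 := hle h hh
  nlinarith

theorem IsGauge.concentration {ε : ℝ} (hε : 0 < ε) : ∃ C : ℝ, 0 < C ∧
    ∀ (φ : ℂ → ℂ → ℝ), IsGauge φ → ∀ (n m : ℕ), 0 < n → C * (n : ℝ) ≤ m →
    ∀ (x : EuclideanSpace ℂ (Fin n))
      (Ω : Type*) [MeasurableSpace Ω] (P : Measure Ω) [IsProbabilityMeasure P]
      (a : Fin m → Ω → EuclideanSpace ℂ (Fin n)),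
      (∀ j, HasLaw (a j) (complexGaussian n) P) → iIndepFun a P →
      ∃ B : Set Ω, P.real B ≤ Real.exp (-(3 * (n : ℝ))) ∧
        ∀ ω ∉ B, ∀ h, ‖h‖ = 1 → |empMean φ (fun j => a j ω) x h - popMean φ x h| ≤ ε := by
  obtain ⟨c₁, hc₁, H₁⟩ := IsGauge.concentration_point (ε := 1) one_pos
  obtain ⟨c₂, hc₂, H₂⟩ := IsGauge.concentration_point (ε := ε / 2) (by positivity)
  set c := min c₁ c₂ with hc
  have hc0 : 0 < c := lt_min hc₁ hc₂
  -- Passing to the net costs `20 η` for the empirical mean and `5 η / 2` for the population mean,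
  -- together at most `ε / 2`.
  set η := min (1 / 2) (ε / 45) with hη
  have hη0 : 0 < η := lt_min (by norm_num) (by positivity)
  have hη1 : η ≤ 1 / 2 := min_le_left _ _
  have hη2 : η ≤ ε / 45 := min_le_right _ _
  set K := 1 + 2 / η with hK
  have hK1 : 1 < K := by rw [hK]; have : 0 < 2 / η := by positivity
                         linarith
  have hlogK : 0 < Real.log K := Real.log_pos hK1
  -- `2 log K` pays for the size `K ^ (2 n)` of the net, `2` for the factor `4 ≤ exp (2 n)`, and `3`
  -- remains in the exponent.
  refine ⟨(5 + 2 * Real.log K) / c, by positivity, fun φ hφ n m hn hm x Ω _ P _ a ha hind => ?_⟩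
  obtain ⟨N, hNS, hNcard, hnet⟩ := exists_net hη0 {h : EuclideanSpace ℂ (Fin n) | ‖h‖ = 1}
    (fun h hh => le_of_eq hh)
  set A : EuclideanSpace ℂ (Fin n) → Set Ω := fun g =>
    {ω | 1 ≤ |empMean (fun _ v => ‖v‖) (fun j => a j ω) x g - popMean (fun _ v => ‖v‖) x g|}
    ∪ {ω | ε / 2 ≤ |empMean φ (fun j => a j ω) x g - popMean φ x g|} with hA
  refine ⟨⋃ g ∈ N, A g, ?_, fun ω hω h hh => ?_⟩
  · have h1 : ∀ g ∈ N, P.real (A g) ≤ 4 * Real.exp (-(c * m)) := by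
      intro g hg
      have e1 : Real.exp (-(c₁ * m)) ≤ Real.exp (-(c * m)) :=
        Real.exp_le_exp.2 (neg_le_neg (mul_le_mul_of_nonneg_right (min_le_left _ _) (by positivity)))
      have e2 : Real.exp (-(c₂ * m)) ≤ Real.exp (-(c * m)) :=
        Real.exp_le_exp.2 (neg_le_neg (mul_le_mul_of_nonneg_right (min_le_right _ _) (by positivity)))
      refine (measureReal_union_le _ _).trans ?_
      have p1 := H₁ _ isGauge_norm n m x g (hNS g hg) Ω P a ha hind
      have p2 := H₂ φ hφ n m x g (hNS g hg) Ω P a ha hind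
      linarith
    have h2 : P.real (⋃ g ∈ N, A g) ≤ N.card * (4 * Real.exp (-(c * m))) := by
      refine (measureReal_biUnion_finset_le _ _).trans ?_
      rw [← nsmul_eq_mul]
      exact Finset.sum_le_card_nsmul _ _ _ h1
    have hn1 : (1 : ℝ) ≤ n := by exact_mod_cast hn
    have h4 : (4 : ℝ) ≤ Real.exp (2 * n) := by
      have h5 := Real.add_one_le_exp (1 : ℝ)
      have h6 : Real.exp 2 ≤ Real.exp (2 * n) := Real.exp_le_exp.2 (by linarith)
      have h7 : Real.exp 2 = Real.exp 1 * Real.exp 1 := by rw [← Real.exp_add]; norm_num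
      nlinarith
    have hKn : K ^ (2 * n) = Real.exp (2 * n * Real.log K) := by
      have h5 := Real.exp_nat_mul (Real.log K) (2 * n)
      rw [Real.exp_log (by linarith)] at h5
      rw [← h5]
      push_cast
      ring_nf
    have hcm : (5 + 2 * Real.log K) * n ≤ c * m := by
      rw [div_mul_eq_mul_div, div_le_iff₀ hc0] at hm
      linarith
    calc _ ≤ _ := h2
      _ ≤ Real.exp (2 * n * Real.log K) * (Real.exp (2 * n) * Real.exp (-(c * m))) := by
          rw [← hKn]; gcongr
      _ = Real.exp (2 * n * Real.log K + (2 * n + -(c * m))) := by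
          rw [Real.exp_add, Real.exp_add]
      _ ≤ _ := Real.exp_le_exp.2 (by linarith)
  · simp only [hA, Set.mem_iUnion, Set.mem_union, Set.mem_ofPred_eq, not_exists, not_or, not_le]
      at hω
    set b : Fin m → EuclideanSpace ℂ (Fin n) := fun j => a j ω with hb
    have hN2 : ∀ g ∈ N, empMean (fun _ v => ‖v‖) b x g ≤ 2 := by
      intro g hg
      have h1 := (abs_lt.1 (hω g hg).1).2
      have h2 : popMean (fun _ v => ‖v‖) x g = 1 := by
        rw [popMean, (integral_norm_inner_sq g).2, show ‖g‖ = 1 from hNS g hg]; norm_num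
      linarith
    have h8 := empMean_norm_le_of_net hη0.le hη1 hnet hN2
    obtain ⟨g, hg, hhg⟩ := hnet h hh
    have hg1 : ‖g‖ = 1 := hNS g hg
    have hsq : ‖h - g‖ ^ 2 ≤ η ^ 2 := pow_le_pow_left₀ (norm_nonneg _) hhg 2
    have d1 := hφ.abs_empMean_sub_le hη0 b x h g
    have d2 := (hω g hg).2
    have d3 := hφ.abs_popMean_sub_le hη0 x h g
    have k1 := h8 (h - g)
    have k2 := h8 h
    have k3 := h8 g
    rw [hh] at k2 d3
    rw [hg1] at k3 d3
    have r1 : 1 / (2 * η) * empMean (fun _ v => ‖v‖) b x (h - g) ≤ 4 * η := by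
      calc _ ≤ 1 / (2 * η) * (8 * η ^ 2) := by gcongr; linarith
        _ = 4 * η := by field_simp; norm_num
    have r2 : 1 / (2 * η) * ‖h - g‖ ^ 2 ≤ η / 2 := by
      calc _ ≤ 1 / (2 * η) * η ^ 2 := by gcongr
        _ = η / 2 := by field_simp
    have r3 : η * (empMean (fun _ v => ‖v‖) b x h + empMean (fun _ v => ‖v‖) b x g)
        ≤ η * 16 := by gcongr; linarith
    have t1 := abs_sub_le (empMean φ b x h) (empMean φ b x g) (popMean φ x h)
    have t2 := abs_sub_le (empMean φ b x g) (popMean φ x g) (popMean φ x h)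
    rw [abs_sub_comm (popMean φ x g)] at t2
    linarith

/-! ### Homogeneity and reduction to unit vectors. -/

theorem phaseRe_smul (u v : ℂ) {X r : ℝ} (hX : 0 < X) (hr : 0 ≤ r) :
    phaseRe ((X : ℂ) * u) ((r : ℂ) * v) = r * phaseRe u v := by
  have hX' : (X : ℂ) ≠ 0 := by exact_mod_cast hX.ne'
  have e : (if (X : ℂ) * u = 0 then 1 else (X : ℂ) * u / ‖(X : ℂ) * u‖ : ℂ)
      = if u = 0 then 1 else u / ‖u‖ := by
    rcases eq_or_ne u 0 with h | h
    · simp [h]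
    · rw [if_neg (mul_ne_zero hX' h), if_neg h, norm_mul, Complex.norm_real,
        Real.norm_of_nonneg hX.le, Complex.ofReal_mul, mul_div_mul_left _ _ hX']
  rw [phaseRe, e, mul_left_comm, Complex.re_ofReal_mul, abs_mul, abs_of_nonneg hr, phaseRe]

/-- In the neighbourhood `|h| ≤ ρ |x|`, so after normalization the threshold `k` grows to `k / ρ`;
this is the source of the factor `ρ²` in the mean excess. -/
theorem excess_smul_le (u v : ℂ) {k X r ρ : ℝ} (hk : 0 ≤ k) (hρ : 0 < ρ) (hr : 0 ≤ r)
    (hrX : r ≤ ρ * X) :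
    excess k ((X : ℂ) * u) ((r : ℂ) * v) ≤ r * excess (k / ρ) u v := by
  have hX : 0 ≤ X := by
    by_contra hneg
    nlinarith
  rw [excess, excess, norm_mul, norm_mul, Complex.norm_real, Complex.norm_real,
    Real.norm_of_nonneg hX, Real.norm_of_nonneg hr]
  refine max_le ((le_trans ?_ (mul_le_mul_of_nonneg_left (le_max_left _ _) hr)))
    (mul_nonneg hr (le_max_right _ _))
  have h1 : r / ρ ≤ X := by rwa [div_le_iff₀' hρ]
  have h2 : k * ‖u‖ * (r / ρ) ≤ k * ‖u‖ * X := by gcongr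
  have h3 : r * (‖v‖ - k / ρ * ‖u‖) = r * ‖v‖ - k * ‖u‖ * (r / ρ) := by ring
  rw [h3]
  linarith

/-- For `l ≤ u`, `1 - t ≥ (1 - μ u)² ≥ 0`. -/
theorem rate_bounds {l u μ : ℝ} (hlu : l ≤ u) (hu : 0 < u) (hμ : 0 < μ)
    (hμ' : μ < 2 * l / u ^ 2) : 0 < rate l u μ ∧ rate l u μ ≤ 1 := by
  rw [lt_div_iff₀ (by positivity)] at hμ'
  refine ⟨mul_pos hμ (by linarith), ?_⟩
  rw [rate]
  nlinarith [sq_nonneg (1 - μ * u), mul_le_mul_of_nonneg_left hlu hμ.le]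

/-- The curvature condition, deduced from moment bounds for unit vectors. -/
theorem curvature_of_moments {n m : ℕ} {a : Fin m → EuclideanSpace ℂ (Fin n)}
    {x x' : EuclideanSpace ℂ (Fin n)} {ρ A B D : ℝ} (hρ : 0 < ρ) (hx : x = (‖x‖ : ℂ) • x')
    (hA : ∀ h, ‖h‖ = 1 → (inner ℂ x' h : ℂ).im = 0 → A ≤ empMean phaseRe a x' h)
    (hB : ∀ h, ‖h‖ = 1 → empMean (fun _ v => ‖v‖) a x' h ≤ B)
    (hD : ∀ h, ‖h‖ = 1 → empMean (excess (2 / 5 / ρ)) a x' h ≤ D)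
    {h : EuclideanSpace ℂ (Fin n)} (him : (inner ℂ x h : ℂ).im = 0) (hh : ‖h‖ ≤ ρ * ‖x‖) :
    (A - B / 4 - 3 * D) * ‖h‖ ^ 2 ≤ (1 / (m : ℝ)) * ∑ j,
      (phaseRe (inner ℂ (a j) x) (inner ℂ (a j) h) ^ 2 - ‖(inner ℂ (a j) h : ℂ)‖ ^ 2 / 4
        - 3 * excess (2 / 5) (inner ℂ (a j) x) (inner ℂ (a j) h) ^ 2) := by
  rcases eq_or_ne h 0 with rfl | h0
  · have h1 : ∀ u : ℂ, excess (2 / 5) u 0 = 0 := fun u => by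
      rw [excess, norm_zero]; exact max_eq_right (by linarith [norm_nonneg u])
    have h2 : ∀ u : ℂ, phaseRe u 0 = 0 := fun u => by simp [phaseRe]
    simp [h1, h2]
  · have hr : 0 < ‖h‖ := norm_pos_iff.2 h0
    have hX : 0 < ‖x‖ := by
      by_contra hneg
      nlinarith [norm_nonneg x]
    have hn : (‖h‖ : ℂ) ≠ 0 := by simpa using h0
    obtain ⟨g, hg, hgh⟩ : ∃ g : EuclideanSpace ℂ (Fin n), ‖g‖ = 1 ∧ h = (‖h‖ : ℂ) • g := by
      refine ⟨(‖h‖ : ℂ)⁻¹ • h, ?_, ?_⟩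
      · rw [norm_smul]; simp [h0]
      · rw [smul_smul, mul_inv_cancel₀ hn, one_smul]
    have himg : (inner ℂ x' g : ℂ).im = 0 := by
      rw [hx, hgh, inner_smul_left, inner_smul_right, Complex.conj_ofReal, Complex.im_ofReal_mul,
        Complex.im_ofReal_mul] at him
      simpa [hX.ne', hr.ne'] using him
    have hu : ∀ j, (inner ℂ (a j) x : ℂ) = (‖x‖ : ℂ) * inner ℂ (a j) x' := fun j => by
      conv_lhs => rw [hx]
      rw [inner_smul_right]
    have hv : ∀ j, (inner ℂ (a j) h : ℂ) = (‖h‖ : ℂ) * inner ℂ (a j) g := fun j => by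
      conv_lhs => rw [hgh]
      rw [inner_smul_right]
    have hterm : ∀ j, ‖h‖ ^ 2 * (phaseRe (inner ℂ (a j) x') (inner ℂ (a j) g) ^ 2
        - ‖(inner ℂ (a j) g : ℂ)‖ ^ 2 / 4
        - 3 * excess (2 / 5 / ρ) (inner ℂ (a j) x') (inner ℂ (a j) g) ^ 2)
        ≤ phaseRe (inner ℂ (a j) x) (inner ℂ (a j) h) ^ 2 - ‖(inner ℂ (a j) h : ℂ)‖ ^ 2 / 4
        - 3 * excess (2 / 5) (inner ℂ (a j) x) (inner ℂ (a j) h) ^ 2 := by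
      intro j
      rw [hu, hv, phaseRe_smul _ _ hX hr.le, norm_mul, Complex.norm_real, norm_norm]
      have h1 : excess (2 / 5) ((‖x‖ : ℂ) * inner ℂ (a j) x') ((‖h‖ : ℂ) * inner ℂ (a j) g) ^ 2
          ≤ (‖h‖ * excess (2 / 5 / ρ) (inner ℂ (a j) x') (inner ℂ (a j) g)) ^ 2 :=
        pow_le_pow_left₀ (le_max_right _ _) (excess_smul_le _ _ (by norm_num) hρ hr.le hh) 2
      rw [mul_pow] at h1
      rw [mul_pow, mul_pow]
      linarith
    have h1 := hA g hg himg
    have h2 := hB g hg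
    have h3 := hD g hg
    have e : (1 / (m : ℝ)) * ∑ j, ‖h‖ ^ 2 * (phaseRe (inner ℂ (a j) x') (inner ℂ (a j) g) ^ 2
        - ‖(inner ℂ (a j) g : ℂ)‖ ^ 2 / 4
        - 3 * excess (2 / 5 / ρ) (inner ℂ (a j) x') (inner ℂ (a j) g) ^ 2)
        = ‖h‖ ^ 2 * (empMean phaseRe a x' g - empMean (fun _ v => ‖v‖) a x' g / 4
          - 3 * empMean (excess (2 / 5 / ρ)) a x' g) := by
      simp only [empMean]
      rw [← Finset.mul_sum, Finset.sum_sub_distrib, Finset.sum_sub_distrib, ← Finset.sum_div,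
        ← Finset.mul_sum]
      ring
    calc _ ≤ ‖h‖ ^ 2 * (empMean phaseRe a x' g - empMean (fun _ v => ‖v‖) a x' g / 4
          - 3 * empMean (excess (2 / 5 / ρ)) a x' g) := by
          rw [mul_comm]
          exact mul_le_mul_of_nonneg_left (by linarith) (sq_nonneg _)
      _ ≤ _ := by
          rw [← e]
          exact mul_le_mul_of_nonneg_left (Finset.sum_le_sum fun j _ => hterm j) (by positivity)

theorem exists_unit_direction {n : ℕ} (hn : 0 < n) (x : EuclideanSpace ℂ (Fin n)) :
    ∃ x' : EuclideanSpace ℂ (Fin n), ‖x'‖ = 1 ∧ x = (‖x‖ : ℂ) • x' := by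
  rcases eq_or_ne x 0 with rfl | h0
  · exact ⟨EuclideanSpace.single ⟨0, hn⟩ 1, by simp, by simp⟩
  · have hne : (‖x‖ : ℂ) ≠ 0 := by simpa using h0
    refine ⟨(‖x‖ : ℂ)⁻¹ • x, ?_, ?_⟩
    · rw [norm_smul]; simp [h0]
    · rw [smul_smul, mul_inv_cancel₀ hne, one_smul]

end PoissonWF

end
-- Assembly.
theorem theorem1 (α₁ α₂ ρ : ℝ) (hadm : PoissonWF.Admissible α₁ α₂ ρ) :
    (∃ δ₀ : ℝ, 0 < δ₀ ∧ ∀ δ : ℝ, 0 < δ → δ < δ₀ → 0 < PoissonWF.lCur α₁ α₂ ρ δ) ∧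
    ∀ δ : ℝ, 0 < δ → ∀ δ' : ℝ, 0 < δ' → 0 < PoissonWF.lCur α₁ α₂ ρ δ →
      ∃ C : ℝ, 0 < C ∧ ∃ c : ℝ, 0 < c ∧
        ∀ (n m : ℕ), C * (n : ℝ) ≤ (m : ℝ) →
        ∀ (x : EuclideanSpace ℂ (Fin n))
          (Ω : Type*) [MeasurableSpace Ω] (P : Measure Ω) [IsProbabilityMeasure P]
          (a : Fin m → Ω → EuclideanSpace ℂ (Fin n)),
          (∀ j, HasLaw (a j) (PoissonWF.complexGaussian n) P) → iIndepFun a P →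
        ∀ μ : ℝ, 0 < μ →
          μ < 2 * PoissonWF.lCur α₁ α₂ ρ δ / PoissonWF.uSmo α₁ δ' ^ 2 →
          0 < PoissonWF.rate (PoissonWF.lCur α₁ α₂ ρ δ) (PoissonWF.uSmo α₁ δ') μ ∧
          ∀ k : ℕ, ∃ G : Set Ω, MeasurableSet G ∧
            1 - ((k : ℝ) + 1) * Real.exp (-c * (n : ℝ)) ≤ P.real G ∧
            ∀ ω ∈ G, ∀ b : Fin m → ℝ,
              (∀ j, α₁ * ‖inner ℂ (a j ω) x‖ ^ 2 ≤ b j ∧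
                b j ≤ α₂ * ‖inner ℂ (a j ω) x‖ ^ 2) →
              ∀ z₀ ∈ PoissonWF.nbhd x ρ,
                PoissonWF.phaseDist
                    (PoissonWF.wf (fun j => a j ω) b
                      (PoissonWF.data (fun j => a j ω) b x) μ z₀ (k + 1)) x ^ 2
                  ≤ (1 - PoissonWF.rate (PoissonWF.lCur α₁ α₂ ρ δ)
                        (PoissonWF.uSmo α₁ δ') μ) ^ (k + 1)
                    * PoissonWF.phaseDist z₀ x ^ 2 := by
  open PoissonWF in
  refine ⟨lCur_pos_of_small hadm, fun δ hδ δ' hδ' hl => ?_⟩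
  obtain ⟨hρ, hρ', hα, hα', hU3, -⟩ := hadm.bounds
  have hUl := bigU_mul_lCur_le hadm hδ
  have hU1 : 1 + α₂ ≤ bigU α₂ ρ := by rw [bigU]; nlinarith
  have hl1 : lCur α₁ α₂ ρ δ ≤ 1 := by nlinarith
  have hs : 0 < Real.sqrt α₁ := Real.sqrt_pos.2 (by linarith)
  have hu1 : 1 ≤ uSmo α₁ δ' := by
    have : 0 < 1 / (2 * Real.sqrt α₁) := by positivity
    rw [uSmo]; nlinarith
  -- The mean of `|a* h|²` must be within `δ'` for smoothness and within `0.005` for the curvature.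
  obtain ⟨C₁, hC₁, H₁⟩ := IsGauge.concentration (ε := min δ' 0.005) (lt_min hδ' (by norm_num))
  obtain ⟨C₂, hC₂, H₂⟩ := IsGauge.concentration (ε := 0.005) (by norm_num)
  refine ⟨max C₁ C₂, lt_max_of_lt_left hC₁, 1, one_pos,
    fun n m hm x Ω _ P _ a ha hind μ hμ hμ' => ?_⟩
  obtain ⟨hr0, hr1⟩ := rate_bounds (hl1.trans hu1) (by linarith) hμ hμ'
  refine ⟨hr0, fun k => ?_⟩
  rcases Nat.eq_zero_or_pos n with rfl | hn
  -- For `n = 0` the required probability `1 - (k + 1)` is at most `0`.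
  · exact ⟨∅, MeasurableSet.empty, by simp, fun ω hω => hω.elim⟩
  have hm₁ : C₁ * (n : ℝ) ≤ m := le_trans (by gcongr; exact le_max_left _ _) hm
  have hm₂ : C₂ * (n : ℝ) ≤ m := le_trans (by gcongr; exact le_max_right _ _) hm
  obtain ⟨x', hx', hxx'⟩ := exists_unit_direction hn x
  obtain ⟨B₁, hB₁, E₁⟩ := H₁ _ isGauge_norm n m hn hm₁ x' Ω P a ha hind
  obtain ⟨B₂, hB₂, E₂⟩ := H₂ _ isGauge_phaseRe n m hn hm₂ x' Ω P a ha hind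
  obtain ⟨B₃, hB₃, E₃⟩ := H₂ _ (isGauge_excess (k := 2 / 5 / ρ) (by positivity)) n m hn hm₂ x'
    Ω P a ha hind
  -- The exceptional sets need not be measurable, so a measurable hull is removed. The three bounds
  -- `exp (-3n)` combine to `exp (-n)` through `3 ≤ exp (2n)`.
  refine ⟨(toMeasurable P (B₁ ∪ B₂ ∪ B₃))ᶜ, (measurableSet_toMeasurable _ _).compl, ?_,
    fun ω hω b hb z₀ hz₀ => ?_⟩
  · have h1 : P.real (toMeasurable P (B₁ ∪ B₂ ∪ B₃)) ≤ 3 * Real.exp (-(3 * (n : ℝ))) := by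
      rw [Measure.real, measure_toMeasurable]
      have h2 := measureReal_union_le (μ := P) (B₁ ∪ B₂) B₃
      have h3 := measureReal_union_le (μ := P) B₁ B₂
      rw [Measure.real] at h2
      linarith
    rw [probReal_compl_eq_one_sub (measurableSet_toMeasurable _ _)]
    have hn1 : (1 : ℝ) ≤ n := by exact_mod_cast hn
    have h4 : 3 ≤ Real.exp (2 * (n : ℝ)) := by linarith [Real.add_one_le_exp (2 * (n : ℝ))]
    have h5 : 3 * Real.exp (-(3 * (n : ℝ))) ≤ Real.exp (-1 * (n : ℝ)) := by
      calc _ ≤ Real.exp (2 * (n : ℝ)) * Real.exp (-(3 * (n : ℝ))) := by gcongr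
        _ = _ := by rw [← Real.exp_add]; congr 1; ring
    have h6 : 0 ≤ (k : ℝ) * Real.exp (-1 * (n : ℝ)) := by positivity
    linarith
  · have hω' : ω ∉ B₁ ∪ B₂ ∪ B₃ := fun h => hω (subset_toMeasurable _ _ h)
    simp only [Set.mem_union, not_or] at hω'
    obtain ⟨⟨hω₁, hω₂⟩, hω₃⟩ := hω'
    have F₁ : ∀ h : EuclideanSpace ℂ (Fin n), ‖h‖ = 1 →
        empMean (fun _ v => ‖v‖) (fun j => a j ω) x' h ≤ 1 + min δ' 0.005 := by
      intro h hh
      have h1 := (abs_le.1 (E₁ ω hω₁ h hh)).2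
      have h2 : popMean (fun _ v => ‖v‖) x' h = 1 := by
        rw [popMean, (integral_norm_inner_sq h).2, hh, one_pow]
      linarith
    have hmin₁ : min δ' 0.005 ≤ δ' := min_le_left _ _
    have hmin₂ : min δ' 0.005 ≤ 0.005 := min_le_right _ _
    refine phaseDist_wf_le (α₂ := α₂) (U := bigU α₂ ρ) (ρ := ρ)
      -- The population means `1/2`, `1`, `2.35 ρ²`, each worsened by `0.005`.
      (κ := (0.495 - 1.005 / 4 - 3 * (2.35 * ρ ^ 2 + 0.005)))
      hα hα' hU3 hU1 (by linarith) hμ.le hr0.le hr1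
      (hUl.trans (by nlinarith)) hb (fun h => ?_) (fun h him hh => ?_) hz₀ (k + 1)
    · exact empMean_norm_le_of_unit (x := x') (fun h hh => (F₁ h hh).trans (by linarith)) h
    · refine curvature_of_moments hρ hxx' (fun h hh him => ?_) (fun h hh => ?_) (fun h hh => ?_)
        him hh
      · have h1 := (abs_le.1 (E₂ ω hω₂ h hh)).1
        have h2 : 1 / 2 ≤ popMean phaseRe x' h := integral_phaseRe_ge hx' hh him
        linarith
      · linarith [F₁ h hh]
      · have h1 := (abs_le.1 (E₃ ω hω₃ h hh)).2
        have h2 : popMean (excess (2 / 5 / ρ)) x' h ≤ 2.35 * ρ ^ 2 :=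
          integral_excess_le hx' hh hρ hρ'
        linarith
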